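/- Let $l\ge -\tfrac12$ and let $q:(0,1)\to\mathbb R$ be measurable. Put $\tilde q(x)=|q(x)|$ if $l>-\tfrac12$ and $\tilde q(x)=(1-\log x)|q(x)|$ if $l=-\tfrac12$, and assume $x\,\tilde q(x)\in L^1(0,1)$. All powers and logarithms of complex numbers are principal (cut along the negative real axis). For $z\in\mathbb C$ and $0<x\le 1$ let $$\phi_l(z,x)=z^{-\frac{2l+1}{4}}\sqrt{\tfrac{\pi x}{2}}\,J_{l+\frac12}(\sqrt z\,x),$$ $$\theta_l(z,x)=-z^{\frac{2l+1}{4}}\sqrt{\tfrac{\pi x}{2}}\begin{cases}\dfrac{-1}{\sin((l+\frac12)\pi)}J_{-l-\frac12}(\sqrt z\,x), & l+\tfrac12\notin\mathbb N_0,\\[2mm] Y_{l+\frac12}(\sqrt z\,x)-\tfrac1\pi\log(z)\,J_{l+\frac12}(\sqrt z\,x), & l+\tfrac12\in\mathbb N_0,\end{cases}$$ where $J_\nu$, $Y_\nu$ are the Bessel and Neumann functions and the values at $z=0$ are the limits as $z\to0$. With primes denoting derivatives in $x$, set $$G_l(z,x,y)=\phi_l(z,x)\theta_l(z,y)-\phi_l(z,y)\theta_l(z,x),\qquad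 \psi_l^\infty(z,x)=\theta_l(z,1)\phi_l(z,x)-\phi_l(z,1)\theta_l(z,x),$$ and for $\beta\in\mathbb R$ $$\psi_l^\beta(z,x)=-\big(\beta\theta_l(z,1)+\theta_l'(z,1)\big)\phi_l(z,x)+\big(\beta\phi_l(z,1)+\phi_l'(z,1)\big)\theta_l(z,x).$$ Then for every $\beta\in\mathbb R\cup\{\infty\}$ there is a function $\psi^\beta(z,x)$, $z\in\mathbb C$, $0<x\le1$, with the following properties. (i) For every $z$, $u=\psi^\beta(z,\cdot)$ is a solution of $-u''+\frac{l(l+1)}{x^2}u+qu=zu$ on $(0,1)$, that is, $u$ is continuously differentiable and $u'$ is locally absolutely continuous on $(0,1]$, and the equation holds almost everywhere. It satisfies $\big(\psi^\beta(z,1),(\psi^\beta)'(z,1)\big)=(1,-\beta)$ if $\beta\in\mathbb R$, and $\big(\psi^\infty(z,1),(\psi^\infty)'(z,1)\big)=(0,1)$ if $\beta=\infty$. (ii) For every $x\in(0,1]$ the function $z\mapsto\psi^\beta(z,x)$ is entire. (iii) For all $z\in\mathbb C$ and $x\in(0,1]$ the following integral converges absolutely and $$\psi^\beta(z,x)=\psi^\beta_l(z,x)-\int_x^1G_l(z,x,y)\,q(y)\,\psi^\beta(z,y)\,dy.$$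 (iv) There is a constant $C$, depending on $l$, $q$ and $\beta$ but not on $z$ or $x$, such that for all $z\in\mathbb C$ and $x\in(0,1]$, if $l>-\tfrac12$, $$|\psi^\beta(z,x)-\psi_l^\beta(z,x)|\le C\Big(\frac{1+|z|^{1/2}x}{x+|z|^{1/2}x}\Big)^{l}e^{|\mathrm{Im}(z^{1/2})|(1-x)}\int_x^1\frac{y\,\tilde q(y)}{1+|z|^{1/2}y}\,dy\qquad(\beta\in\mathbb R),$$ $$|\psi^\infty(z,x)-\psi_l^\infty(z,x)|\le C\Big(\frac{1+|z|^{1/2}x}{x+|z|^{1/2}x}\Big)^{l}\frac{e^{|\mathrm{Im}(z^{1/2})|(1-x)}}{1+|z|^{1/2}}\int_x^1\frac{y\,\tilde q(y)}{1+|z|^{1/2}y}\,dy.$$ If $l=-\tfrac12$, the same estimates hold with an additional factor $(1-\log x)$ on the right-hand sides. -/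

import Mathlib

open MeasureTheory Set

namespace SphericalSchrodinger

noncomputable section

/-- Bessel function of the first kind,
`J_ν(w) = (w/2)^ν ∑ₖ (-1)^k (w/2)^(2k) / (k! Γ(ν+k+1))`, principal branch of the power.
(`Complex.Gamma` is `0` at its poles, so the quotient by it is `0` there, as it should be.) -/
def besselJ (ν : ℝ) (w : ℂ) : ℂ :=
  (w / 2) ^ (ν : ℂ) *
    ∑' k : ℕ, (-1) ^ k / ((k.factorial : ℂ) * Complex.Gamma ((ν : ℂ) + k + 1)) * (w / 2) ^ (2 * k)

/-- The digamma function at the positive integer `m + 1`, that is, `H_m - γ`. -/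
def digammaSucc (m : ℕ) : ℝ :=
  (harmonic m : ℝ) - Real.eulerMascheroniConstant

/-- Neumann function (Bessel function of the second kind) `Y_n` of integer order `n ≥ 0`,
by its classical series, with the principal branch of the logarithm. -/
def besselY (n : ℕ) (w : ℂ) : ℂ :=
  -(((w / 2) ^ n)⁻¹ / (Real.pi : ℂ)) *
      ∑ k ∈ Finset.range n, ((n - k - 1).factorial : ℂ) / (k.factorial : ℂ) * (w / 2) ^ (2 * k)
    + 2 / (Real.pi : ℂ) * Complex.log (w / 2) * besselJ n w
    - (w / 2) ^ n / (Real.pi : ℂ) *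
      ∑' k : ℕ, ((digammaSucc k + digammaSucc (n + k) : ℝ) : ℂ) * (-1) ^ k /
        ((k.factorial : ℂ) * ((n + k).factorial : ℂ)) * (w / 2) ^ (2 * k)

/-- The principal square root of a complex number (branch cut along the negative real axis). -/
def csqrt (z : ℂ) : ℂ := z ^ (1 / 2 : ℂ)

/-- `φ_l(z,x) = z^{-(2l+1)/4} √(πx/2) J_{l+1/2}(√z x)`; the value at the removable singularity
`z = 0` is the limit `x^{l+1} √π / (Γ(l+3/2) 2^{l+1})`. -/
def phiFree (l : ℝ) (z : ℂ) (x : ℝ) : ℂ :=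
  if z = 0 then
    ((x ^ (l + 1) * (Real.sqrt Real.pi / (Real.Gamma (l + 3 / 2) * 2 ^ (l + 1))) : ℝ) : ℂ)
  else
    z ^ ((-((2 * l + 1) / 4) : ℝ) : ℂ) * (Real.sqrt (Real.pi * x / 2) : ℂ) *
      besselJ (l + 1 / 2) (csqrt z * x)

/-- `θ_l(z,x)`: equal to `z^{(2l+1)/4} √(πx/2) J_{-l-1/2}(√z x) / sin((l+1/2)π)` if `l + 1/2` is
not a nonnegative integer, and to `-z^{(2l+1)/4} √(πx/2) (Y_n(√z x) - (1/π) log(z) J_n(√z x))` if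
`l + 1/2 = n` is a nonnegative integer; the value at the removable singularity `z = 0` is the
limit. -/
def thetaFree (l : ℝ) (z : ℂ) (x : ℝ) : ℂ :=
  if z = 0 then
    if l = -1 / 2 then
      ((Real.sqrt (2 * x / Real.pi) *
        (Real.log 2 - Real.eulerMascheroniConstant - Real.log x) : ℝ) : ℂ)
    else
      ((Real.Gamma (l + 3 / 2) * 2 ^ (l + 1) / (x ^ l * Real.sqrt Real.pi) *
        (1 / (2 * l + 1)) : ℝ) : ℂ)
  else
    -(z ^ (((2 * l + 1) / 4 : ℝ) : ℂ)) * (Real.sqrt (Real.pi * x / 2) : ℂ) *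
      if (⌊l + 1 / 2⌋₊ : ℝ) = l + 1 / 2 then
        besselY ⌊l + 1 / 2⌋₊ (csqrt z * x)
          - 1 / (Real.pi : ℂ) * Complex.log z * besselJ (l + 1 / 2) (csqrt z * x)
      else
        ((-1 / Real.sin ((l + 1 / 2) * Real.pi) : ℝ) : ℂ) * besselJ (-l - 1 / 2) (csqrt z * x)

/-- `G_l(z,x,y) = φ_l(z,x) θ_l(z,y) - φ_l(z,y) θ_l(z,x)`. -/
def green (l : ℝ) (z : ℂ) (x y : ℝ) : ℂ :=
  phiFree l z x * thetaFree l z y - phiFree l z y * thetaFree l z x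

/-- `ψ_l^∞(z,x) = θ_l(z,1) φ_l(z,x) - φ_l(z,1) θ_l(z,x)`. -/
def psiFreeInf (l : ℝ) (z : ℂ) (x : ℝ) : ℂ :=
  thetaFree l z 1 * phiFree l z x - phiFree l z 1 * thetaFree l z x

/-- `ψ_l^β(z,x) = -(β θ_l(z,1) + θ_l'(z,1)) φ_l(z,x) + (β φ_l(z,1) + φ_l'(z,1)) θ_l(z,x)`,
where the prime is the derivative in `x`. -/
def psiFree (l β : ℝ) (z : ℂ) (x : ℝ) : ℂ :=
  -((β : ℂ) * thetaFree l z 1 + deriv (thetaFree l z) 1) * phiFree l z x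
    + ((β : ℂ) * phiFree l z 1 + deriv (phiFree l z) 1) * thetaFree l z x

/-- The factor `1 - log x` if `l = -1/2`, and `1` otherwise. -/
def logFactor (l x : ℝ) : ℝ := if l = -1 / 2 then 1 - Real.log x else 1

/-- `q̃ = |q|` for `l > -1/2`, and `q̃(x) = (1 - log x) |q(x)|` for `l = -1/2`. -/
def qTilde (l : ℝ) (q : ℝ → ℝ) (x : ℝ) : ℝ := logFactor l x * |q x|

/-- The standing assumption on `l` and the real potential `q`: `l ≥ -1/2`, `q` is measurable and
`x q̃(x)` is in `L¹(0,1)`. -/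
structure Admissible (l : ℝ) (q : ℝ → ℝ) : Prop where
  le_l : -1 / 2 ≤ l
  measurable : AEMeasurable q (volume.restrict (Ioo 0 1))
  integrable : IntegrableOn (fun x => x * qTilde l q x) (Ioo 0 1)

/-- `u`, with derivative `u'` on `(0,1]` (one-sided at `1`), solves
`-u'' + l(l+1)/x² u + q u = z u` on `(0,1)`: `u'` is locally absolutely continuous on `(0,1]` and
the equation holds almost everywhere. -/
structure IsSolution (l : ℝ) (q : ℝ → ℝ) (z : ℂ) (u u' : ℝ → ℂ) : Prop where
  hasDeriv : ∀ x ∈ Ioc (0 : ℝ) 1, HasDerivWithinAt u (u' x) (Ioc 0 1) x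
  absCont : ∀ a ∈ Ioo (0 : ℝ) 1, AbsolutelyContinuousOnInterval u' a 1
  equation : ∀ᵐ x ∂(volume.restrict (Ioo (0 : ℝ) 1)), ∃ w : ℂ, HasDerivAt u' w x ∧
    -w + ((l * (l + 1) / x ^ 2 : ℝ) : ℂ) * u x + (q x : ℂ) * u x = z * u x

/-- `((1 + |z|^{1/2} x) / (x + |z|^{1/2} x))^l e^{|Im z^{1/2}| (1-x)}
  ∫_x^1 y q̃(y) / (1 + |z|^{1/2} y) dy`. -/
def errorBound (l : ℝ) (q : ℝ → ℝ) (z : ℂ) (x : ℝ) : ℝ :=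
  ((1 + Real.sqrt ‖z‖ * x) / (x + Real.sqrt ‖z‖ * x)) ^ l *
    Real.exp (|(csqrt z).im| * (1 - x)) *
    ∫ y in x..1, y * qTilde l q y / (1 + Real.sqrt ‖z‖ * y)

end

end SphericalSchrodinger

open SphericalSchrodinger

open MeasureTheory Set Filter Topology

namespace SphericalSchrodinger

/-! ### Absolutely continuous functions -/

/-! The endpoint `1` is regular, so `ψ` can be defined by its Cauchy data there. Picard iteration
for `u'' = (V - z) u`, started at `1`, produces iterates polynomial in `z` that converge locally
uniformly; the sum is entire in `z` (`exists_entire_solution`).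

As a function of `y`, the kernel `green l z x y` is the free solution `g` with `g(x) = 0` and `g'(x)
= -1`. This follows from the free equation for `φ_l`, `θ_l` and from the Wronskian `θ_l φ_l' - θ_l'
φ_l = 1`, both read off from Frobenius series (`exists_free_solutions`). Integrating `(g u' - g' u)'
= g q u` over `[x, 1]` then gives the integral equation
(`IsIntegratedSolution.variation_of_constants`).

The kernel is estimated from the differential equation alone, without Bessel asymptotics. With `m(x)
= x / (1 + |z|^{1/2} x)`, `κ = |Im z^{1/2}|` and `Λ` the logarithmic factor, `exists_free_bound`
gives `|G(x,y)| ≤ C m(x)^{-l} m(y)^{l+1} e^{κ(y-x)} Λ(x)`, and the same with `m(y)^l` for the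
`y`-derivative. For `|z|^{1/2} y ≤ 1` the equation is a perturbation of its `z = 0` case; beyond
that point an energy estimate takes over.

Finally, divide `u` by `M(x) = m(x)^{-l} e^{κ(1-x)} Λ(x)`. The kernel of the integral equation is
then dominated by `C y q̃(y) / (1 + |z|^{1/2} y)`, whose integral over `(0,1)` is bounded uniformly
in `z`, and Grönwall applies (`norm_sub_free_le`). The datum `u'(1)` enters the free part with one
more power of `m(1) = 1 / (1 + |z|^{1/2})` than `u(1)`, which accounts for the gain when `β = ∞`. -/

theorem absolutelyContinuousOnInterval_of_dist_le {X Y : Type*} [PseudoMetricSpace X]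
    [PseudoMetricSpace Y] {f : ℝ → X} {g : ℝ → Y} {a b : ℝ}
    (hg : AbsolutelyContinuousOnInterval g a b)
    (h : ∀ x ∈ uIcc a b, ∀ y ∈ uIcc a b, dist (f x) (f y) ≤ dist (g x) (g y)) :
    AbsolutelyContinuousOnInterval f a b := by
  rw [absolutelyContinuousOnInterval_iff] at hg ⊢
  intro ε hε
  obtain ⟨δ, hδ, H⟩ := hg ε hε
  refine ⟨δ, hδ, fun E hE hl => (Finset.sum_le_sum fun i hi => ?_).trans_lt (H E hE hl)⟩
  exact h _ (hE.1 i hi).1 _ (hE.1 i hi).2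

/-- Increments of the primitive are dominated by those of the primitive of `‖f‖`, so the real-valued
case suffices. -/
theorem absolutelyContinuousOnInterval_integral {E : Type*} [NormedAddCommGroup E]
    [NormedSpace ℝ E] {f : ℝ → E} {a b c : ℝ}
    (h : IntervalIntegrable f volume a b) (hc : c ∈ uIcc a b) :
    AbsolutelyContinuousOnInterval (fun x => ∫ v in c..x, f v) a b := by
  have hsub : ∀ x ∈ uIcc a b, ∀ y ∈ uIcc a b, IntervalIntegrable f volume x y := fun x hx y hy =>
    h.mono_set (uIcc_subset_uIcc hx hy)
  refine absolutelyContinuousOnInterval_of_dist_le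
    (h.norm.absolutelyContinuousOnInterval_intervalIntegral hc) fun x hx y hy => ?_
  rw [dist_eq_norm, dist_eq_norm,
    intervalIntegral.integral_interval_sub_left (hsub _ hc _ hx) (hsub _ hc _ hy),
    intervalIntegral.integral_interval_sub_left (hsub _ hc _ hx).norm (hsub _ hc _ hy).norm]
  simpa using intervalIntegral.norm_integral_le_abs_integral_norm (f := f) (a := y) (b := x)

/-- `f` is bounded on the interval, and a `C¹` function is Lipschitz on a compact interval
containing its values. -/
theorem _root_.AbsolutelyContinuousOnInterval.comp_contDiff {f : ℝ → ℝ} {a b : ℝ} {φ : ℝ → ℝ}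
    (hf : AbsolutelyContinuousOnInterval f a b) (hφ : ContDiff ℝ 1 φ) :
    AbsolutelyContinuousOnInterval (fun x => φ (f x)) a b := by
  obtain ⟨C, hC⟩ := hf.exists_bound
  obtain ⟨K, hK⟩ := (hφ.contDiffOn (s := Icc (-C) C)).exists_lipschitzOnWith (by decide)
    (convex_Icc _ _) isCompact_Icc
  refine absolutelyContinuousOnInterval_of_dist_le (hf.const_mul (K : ℝ)) fun x hx y hy => ?_
  have h1 := hK.dist_le_mul _ (abs_le.1 (hC x hx)) _ (abs_le.1 (hC y hy))
  rwa [Real.dist_eq ((K : ℝ) * _), ← mul_sub, abs_mul, NNReal.abs_eq, ← Real.dist_eq]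

/-- The difference between `F` and the primitive of `f` is absolutely continuous with derivative
zero almost everywhere, hence constant. -/
theorem integral_eq_sub_of_ae_hasDerivAt {E : Type*} [NormedAddCommGroup E]
    [NormedSpace ℝ E] [CompleteSpace E] {F f : ℝ → E} {a b : ℝ}
    (hF : AbsolutelyContinuousOnInterval F a b) (hf : IntervalIntegrable f volume a b)
    (hd : ∀ᵐ x, x ∈ uIcc a b → HasDerivAt F (f x) x) :
    ∫ x in a..b, f x = F b - F a := by
  have hac := hF.sub (absolutelyContinuousOnInterval_integral hf left_mem_uIcc)
  obtain ⟨C, hC⟩ := hac.const_of_ae_hasDerivAt_zero (by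
    filter_upwards [hd, hf.ae_hasDerivAt_integral] with x h1 h2 hx
    simpa using! (h1 hx).sub (h2 hx a left_mem_uIcc))
  have h1 := hC a left_mem_uIcc
  have h2 := hC b right_mem_uIcc
  simp only [Pi.sub_apply, intervalIntegral.integral_same, sub_zero] at h1 h2
  rw [h1, ← h2]; abel

theorem le_of_ae_hasDerivAt_nonneg {F : ℝ → ℝ} {a b : ℝ} (hab : a ≤ b)
    (hF : AbsolutelyContinuousOnInterval F a b)
    (hd : ∀ᵐ x, x ∈ uIcc a b → ∃ w, 0 ≤ w ∧ HasDerivAt F w x) : F a ≤ F b := by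
  rw [← sub_nonneg, ← hF.integral_deriv_eq_sub]
  refine intervalIntegral.integral_nonneg_of_ae_restrict hab ?_
  refine (ae_restrict_iff' measurableSet_Icc).2 ?_
  filter_upwards [hd] with x h hx
  obtain ⟨w, hw, h⟩ := h (by rwa [uIcc_of_le hab])
  simpa [h.deriv] using hw

theorem ae_hasDerivAt_integral_right {E : Type*} [NormedAddCommGroup E]
    [NormedSpace ℝ E] [CompleteSpace E] {f : ℝ → E} {a b : ℝ}
    (hf : IntervalIntegrable f volume a b) :
    ∀ᵐ x, x ∈ uIcc a b → HasDerivAt (fun x => ∫ t in x..b, f t) (-f x) x := by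
  filter_upwards [hf.ae_hasDerivAt_integral] with x h hx
  simp only [intervalIntegral.integral_symm b]
  exact (h hx b right_mem_uIcc).fun_neg

theorem absolutelyContinuousOnInterval_integral_right {E : Type*} [NormedAddCommGroup E]
    [NormedSpace ℝ E] {f : ℝ → E} {a b : ℝ} (h : IntervalIntegrable f volume a b) :
    AbsolutelyContinuousOnInterval (fun x => ∫ v in x..b, f v) a b := by
  simp only [intervalIntegral.integral_symm b]
  exact (absolutelyContinuousOnInterval_integral h right_mem_uIcc).fun_neg

/-- The substitution `s = ∫_t^b w` in `∫_a^b c w(t) exp (c ∫_t^b w) dt`. -/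
theorem integral_mul_exp_integral {w : ℝ → ℝ} {a b : ℝ} (c : ℝ)
    (hw : IntervalIntegrable w volume a b) :
    IntervalIntegrable (fun t => c * w t * Real.exp (c * ∫ s in t..b, w s)) volume a b ∧
    ∫ t in a..b, c * w t * Real.exp (c * ∫ s in t..b, w s) =
      Real.exp (c * ∫ s in a..b, w s) - 1 := by
  have hac := (absolutelyContinuousOnInterval_integral_right hw).comp_contDiff
    (φ := fun y => Real.exp (c * y)) (by fun_prop)
  have hint : IntervalIntegrable (fun t => c * w t * Real.exp (c * ∫ s in t..b, w s)) volume a b :=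
    (hw.const_mul c).mul_continuousOn hac.continuousOn
  refine ⟨hint, ?_⟩
  have := integral_eq_sub_of_ae_hasDerivAt hac.neg hint.neg.neg (by
    filter_upwards [ae_hasDerivAt_integral_right hw] with x h hx
    convert! (((h hx).const_mul c).exp).neg using 1
    simp only [Pi.neg_apply]
    ring)
  simp only [Pi.neg_apply, intervalIntegral.integral_same, mul_zero, Real.exp_zero, neg_neg] at this
  linarith

/-- **Grönwall's inequality** with an integrable coefficient. -/
theorem le_mul_exp_of_le_add_integral {g w : ℝ → ℝ} {a b A : ℝ} (hab : a ≤ b)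
    (hg : ContinuousOn g (Icc a b)) (hw : IntervalIntegrable w volume a b)
    (hw0 : ∀ t ∈ Icc a b, 0 ≤ w t)
    (h : ∀ x ∈ Icc a b, g x ≤ A + ∫ t in x..b, w t * g t) :
    g a ≤ A * Real.exp (∫ t in a..b, w t) := by
  have hwg : IntervalIntegrable (fun t => w t * g t) volume a b :=
    hw.mul_continuousOn (by rwa [uIcc_of_le hab])
  have hlip : AbsolutelyContinuousOnInterval (fun _ : ℝ => A) a b :=
    ContDiffOn.absolutelyContinuousOnInterval contDiffOn_const
  have h1 := hlip.fun_add (absolutelyContinuousOnInterval_integral_right hwg)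
  have h2 := (absolutelyContinuousOnInterval_integral_right hw).comp_contDiff
    (φ := fun y => Real.exp (-y)) (by fun_prop)
  -- `(A + ∫_x^b w g) exp(-∫_x^b w)` is nondecreasing in `x`: its derivative is `w (A + ∫_x^b w g -
  -- g) exp(-∫_x^b w)`, nonnegative by hypothesis.
  have h3 := le_of_ae_hasDerivAt_nonneg hab (h1.fun_mul h2) (by
    filter_upwards [ae_hasDerivAt_integral_right hw, ae_hasDerivAt_integral_right hwg]
      with x d1 d2 hx
    refine ⟨_, ?_, ((d2 hx).const_add A).mul (d1 hx).neg.exp⟩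
    rw [uIcc_of_le hab] at hx
    simp only [Pi.neg_apply, neg_neg]
    have := mul_nonneg (mul_nonneg (hw0 x hx) (sub_nonneg.2 (h x hx)))
      (Real.exp_nonneg (-∫ t in x..b, w t))
    linarith)
  simp only [intervalIntegral.integral_same, neg_zero, Real.exp_zero, add_zero, mul_one] at h3
  rw [Real.exp_neg, ← div_eq_mul_inv, div_le_iff₀ (Real.exp_pos _)] at h3
  exact (h a (left_mem_Icc.2 hab)).trans h3

/-! ### Initial value problem at `1` for an entire family of equations -/

theorem uIcc_subset_Ioc {a : ℝ} (ha : a ∈ Ioc (0 : ℝ) 1) : uIcc a 1 ⊆ Ioc 0 1 := by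
  rw [uIcc_of_le ha.2]; exact fun x hx => ⟨ha.1.trans_le hx.1, hx.2⟩

theorem mem_Ioc_of_mem_Icc {x t : ℝ} (hx : x ∈ Ioc (0 : ℝ) 1) (ht : t ∈ Icc x 1) :
    t ∈ Ioc (0 : ℝ) 1 := ⟨hx.1.trans_le ht.1, ht.2⟩

theorem intervalIntegrable_of_continuousOn_Ioc {E : Type*} [NormedAddCommGroup E] {g : ℝ → E}
    (hg : ContinuousOn g (Ioc 0 1)) {a : ℝ} (ha : a ∈ Ioc (0 : ℝ) 1) :
    IntervalIntegrable g volume a 1 :=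
  (hg.mono (uIcc_subset_Ioc ha)).intervalIntegrable

theorem Icc_mem_nhdsWithin_Ioc {x : ℝ} (hx : x ∈ Ioc (0 : ℝ) 1) :
    Icc (x / 2) 1 ∈ 𝓝[Ioc 0 1] x := by
  refine mem_nhdsWithin.2 ⟨Ioi (x / 2), isOpen_Ioi, ?_, fun y hy => ⟨(mem_Ioi.1 hy.1).le, hy.2.2⟩⟩
  simpa using hx.1

theorem continuousOn_integral_right {E : Type*} [NormedAddCommGroup E]
    [NormedSpace ℝ E] {g : ℝ → E} (hg : ∀ a ∈ Ioc (0 : ℝ) 1, IntervalIntegrable g volume a 1) :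
    ContinuousOn (fun x => ∫ t in x..1, g t) (Ioc 0 1) := by
  intro x hx
  have hx2 : x / 2 ∈ Ioc (0 : ℝ) 1 := ⟨half_pos hx.1, by linarith [hx.1, hx.2]⟩
  have h := (absolutelyContinuousOnInterval_integral_right (hg _ hx2)).continuousOn
  rw [uIcc_of_le hx2.2] at h
  exact (h x ⟨by linarith [hx.1], hx.2⟩).mono_of_mem_nhdsWithin (Icc_mem_nhdsWithin_Ioc hx)

theorem hasDerivWithinAt_integral_right {g : ℝ → ℂ} (hg : ContinuousOn g (Ioc 0 1)) {x : ℝ}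
    (hx : x ∈ Ioc (0 : ℝ) 1) :
    HasDerivWithinAt (fun x => ∫ t in x..1, g t) (-g x) (Ioc 0 1) x := by
  have hx2 : x / 2 ∈ Ioc (0 : ℝ) 1 := ⟨half_pos hx.1, by linarith [hx.1, hx.2]⟩
  have hsub : Icc (x / 2) 1 ⊆ Ioc 0 1 := by
    have := uIcc_subset_Ioc hx2; rwa [uIcc_of_le hx2.2] at this
  have hxm : x ∈ Icc (x / 2) 1 := ⟨by linarith [hx.1], hx.2⟩
  have : Fact (x ∈ Icc (x / 2) 1) := ⟨hxm⟩
  refine (intervalIntegral.integral_hasDerivWithinAt_left (s := Icc (x / 2) 1) (t := Icc (x / 2) 1)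
    (intervalIntegrable_of_continuousOn_Ioc hg hx)
    ((hg.mono hsub).stronglyMeasurableAtFilter_nhdsWithin measurableSet_Icc x)
    ((hg.mono hsub) x hxm)).mono_of_mem_nhdsWithin (Icc_mem_nhdsWithin_Ioc hx)

/-- Polynomials in `z` whose coefficients are continuous functions on `(0,1]`. -/
inductive PolynomialFamily : (ℂ → ℝ → ℂ) → Prop
  | monomial (k : ℕ) (c : ℝ → ℂ) (hc : ContinuousOn c (Ioc 0 1)) :
      PolynomialFamily fun z x => z ^ k * c x
  | add {u v : ℂ → ℝ → ℂ} (hu : PolynomialFamily u) (hv : PolynomialFamily v) :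
      PolynomialFamily fun z x => u z x + v z x
  | congr {u v : ℂ → ℝ → ℂ} (hu : PolynomialFamily u)
      (h : ∀ z, ∀ x ∈ Ioc (0 : ℝ) 1, v z x = u z x) : PolynomialFamily v

theorem PolynomialFamily.continuousOn {u : ℂ → ℝ → ℂ} (hu : PolynomialFamily u) (z : ℂ) :
    ContinuousOn (u z) (Ioc 0 1) := by
  induction hu with
  | monomial k c hc => exact continuousOn_const.mul hc
  | add _ _ h1 h2 => exact h1.add h2
  | congr _ h h1 => exact h1.congr (h z)

theorem PolynomialFamily.differentiable {u : ℂ → ℝ → ℂ} (hu : PolynomialFamily u) {x : ℝ}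
    (hx : x ∈ Ioc (0 : ℝ) 1) : Differentiable ℂ fun z => u z x := by
  induction hu with
  | monomial k c hc => fun_prop
  | add _ _ h1 h2 => exact h1.add h2
  | congr _ h h1 => simpa only [h _ x hx] using h1

theorem intervalIntegrable_potential_mul {V : ℝ → ℝ}
    (hV : ∀ a ∈ Ioc (0 : ℝ) 1, IntervalIntegrable V volume a 1) {f : ℝ → ℂ}
    (hf : ContinuousOn f (Ioc 0 1)) (z : ℂ) {a : ℝ} (ha : a ∈ Ioc (0 : ℝ) 1) :
    IntervalIntegrable (fun s => ((V s : ℂ) - z) * f s) volume a 1 :=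
  have h : IntervalIntegrable (fun s => (V s : ℂ)) volume a 1 :=
    ⟨(hV a ha).1.ofReal, (hV a ha).2.ofReal⟩
  (h.sub intervalIntegrable_const).mul_continuousOn (hf.mono (uIcc_subset_Ioc ha))

/-- One step of the Picard iteration for `u'' = (V - z) u`. -/
noncomputable def picardStep (V : ℝ → ℝ) (u : ℂ → ℝ → ℂ) (z : ℂ) (x : ℝ) : ℂ :=
  ∫ t in x..1, ∫ s in t..1, ((V s : ℂ) - z) * u z s

theorem picardStep_add {V : ℝ → ℝ}
    (hV : ∀ a ∈ Ioc (0 : ℝ) 1, IntervalIntegrable V volume a 1) {u v : ℂ → ℝ → ℂ} {z : ℂ}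
    (hu : ContinuousOn (u z) (Ioc 0 1)) (hv : ContinuousOn (v z) (Ioc 0 1)) {x : ℝ}
    (hx : x ∈ Ioc (0 : ℝ) 1) :
    picardStep V (fun z x => u z x + v z x) z x = picardStep V u z x + picardStep V v z x := by
  unfold picardStep
  have h1 := fun t (ht : t ∈ Ioc (0 : ℝ) 1) => intervalIntegrable_potential_mul hV hu z ht
  have h2 := fun t (ht : t ∈ Ioc (0 : ℝ) 1) => intervalIntegrable_potential_mul hV hv z ht
  rw [← intervalIntegral.integral_add
    (intervalIntegrable_of_continuousOn_Ioc (continuousOn_integral_right h1) hx)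
    (intervalIntegrable_of_continuousOn_Ioc (continuousOn_integral_right h2) hx)]
  refine intervalIntegral.integral_congr fun t ht => ?_
  have ht' := uIcc_subset_Ioc hx ht
  simp only [mul_add]
  exact intervalIntegral.integral_add (h1 t ht') (h2 t ht')

theorem picardStep_congr {V : ℝ → ℝ} {u v : ℂ → ℝ → ℂ} {z : ℂ}
    (h : ∀ x ∈ Ioc (0 : ℝ) 1, v z x = u z x) {x : ℝ} (hx : x ∈ Ioc (0 : ℝ) 1) :
    picardStep V v z x = picardStep V u z x := by
  unfold picardStep
  refine intervalIntegral.integral_congr fun t ht => ?_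
  have ht' := uIcc_subset_Ioc hx ht
  refine intervalIntegral.integral_congr fun s hs => ?_
  simp only [h s (uIcc_subset_Ioc ht' hs)]

theorem PolynomialFamily.picardStep {V : ℝ → ℝ}
    (hV : ∀ a ∈ Ioc (0 : ℝ) 1, IntervalIntegrable V volume a 1) {u : ℂ → ℝ → ℂ}
    (hu : PolynomialFamily u) : PolynomialFamily (picardStep V u) := by
  induction hu with
  | monomial k c hc =>
    have h1 : ∀ t ∈ Ioc (0 : ℝ) 1, IntervalIntegrable (fun s => (V s : ℂ) * c s) volume t 1 :=
      fun t ht => by simpa using intervalIntegrable_potential_mul hV hc 0 ht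
    have h2 : ∀ t ∈ Ioc (0 : ℝ) 1, IntervalIntegrable c volume t 1 :=
      fun t ht => intervalIntegrable_of_continuousOn_Ioc hc ht
    have h1' := fun x (hx : x ∈ Ioc (0 : ℝ) 1) =>
      intervalIntegrable_of_continuousOn_Ioc (continuousOn_integral_right h1) hx
    have h2' := fun x (hx : x ∈ Ioc (0 : ℝ) 1) =>
      intervalIntegrable_of_continuousOn_Ioc (continuousOn_integral_right h2) hx
    -- Splitting `V - z`, a step maps `z^k c` to `z^k ∬ V c - z^{k+1} ∬ c`, so the degree rises by
    -- at most one.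
    refine ((PolynomialFamily.monomial k _ (continuousOn_integral_right h1')).add
      (.monomial (k + 1) _ (continuousOn_integral_right h2').neg)).congr fun z x hx => ?_
    simp only [SphericalSchrodinger.picardStep]
    have : ∀ t ∈ Ioc (0 : ℝ) 1, ∫ s in t..1, ((V s : ℂ) - z) * (z ^ k * c s) =
        z ^ k * (∫ s in t..1, (V s : ℂ) * c s) - z ^ (k + 1) * ∫ s in t..1, c s := by
      intro t ht
      rw [← intervalIntegral.integral_const_mul, ← intervalIntegral.integral_const_mul,
        ← intervalIntegral.integral_sub ((h1 t ht).const_mul _) ((h2 t ht).const_mul _)]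
      exact intervalIntegral.integral_congr fun s _ => by ring
    rw [intervalIntegral.integral_congr fun t ht => this t (uIcc_subset_Ioc hx ht),
      intervalIntegral.integral_sub ((h1' x hx).const_mul _) ((h2' x hx).const_mul _),
      intervalIntegral.integral_const_mul, intervalIntegral.integral_const_mul]
    simp only [Pi.neg_apply]
    ring
  | add hu hv h1 h2 =>
    exact (h1.add h2).congr fun z x hx =>
      picardStep_add hV (hu.continuousOn z) (hv.continuousOn z) hx
  | congr _ h h1 => exact h1.congr fun z x hx => picardStep_congr (h z) hx

/-- The Picard iterates for `u'' = (V - z) u`, `u(1) = α`, `u'(1) = β`. -/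
noncomputable def picardTerm (V : ℝ → ℝ) (α β : ℂ) : ℕ → ℂ → ℝ → ℂ
  | 0 => fun _ x => α + β * (x - 1)
  | n + 1 => picardStep V (picardTerm V α β n)

theorem polynomialFamily_picardTerm {V : ℝ → ℝ}
    (hV : ∀ a ∈ Ioc (0 : ℝ) 1, IntervalIntegrable V volume a 1) (α β : ℂ) (n : ℕ) :
    PolynomialFamily (picardTerm V α β n) := by
  induction n with
  | zero =>
    refine (PolynomialFamily.monomial 0 (fun x => α + β * (x - 1)) ?_).congr fun z x _ => ?_
    · fun_prop
    · simp [picardTerm]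
  | succ n ih => exact ih.picardStep hV

/-- With `w = |V| + R`, the weight `exp(2 ∫_x^1 w)` makes every Picard step a contraction by `1/2`:
the inner integral of `2 w exp(2 ∫ w)` is explicit, and the outer one runs over an interval of
length at most `1`. The bound is uniform in `‖z‖ ≤ R`. -/
theorem norm_picardTerm_le {V : ℝ → ℝ}
    (hV : ∀ a ∈ Ioc (0 : ℝ) 1, IntervalIntegrable V volume a 1) (α β : ℂ) {R : ℝ} (n : ℕ)
    {z : ℂ} (hz : ‖z‖ ≤ R) {x : ℝ} (hx : x ∈ Ioc (0 : ℝ) 1) :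
    ‖picardTerm V α β n z x‖ ≤
      (‖α‖ + ‖β‖) * (1 / 2) ^ n * Real.exp (2 * ∫ s in x..1, (|V s| + R)) := by
  have hR : 0 ≤ R := (norm_nonneg z).trans hz
  have hw : ∀ a ∈ Ioc (0 : ℝ) 1, IntervalIntegrable (fun s => |V s| + R) volume a 1 :=
    fun a ha => (hV a ha).abs.add intervalIntegrable_const
  have hΦ : ∀ a ∈ Ioc (0 : ℝ) 1, 0 ≤ ∫ s in a..1, (|V s| + R) := fun a ha =>
    intervalIntegral.integral_nonneg ha.2 fun s _ => by positivity
  have hmono : ∀ x ∈ Ioc (0 : ℝ) 1, ∀ t ∈ Icc x 1,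
      ∫ s in t..1, (|V s| + R) ≤ ∫ s in x..1, (|V s| + R) := fun x hx t ht =>
    intervalIntegral.integral_mono_interval ht.1 ht.2 le_rfl
      (Eventually.of_forall fun s => by simp only [Pi.zero_apply]; positivity) (hw x hx)
  induction n generalizing x with
  | zero =>
    have h1 : ‖((x - 1 : ℝ) : ℂ)‖ ≤ 1 := by
      rw [Complex.norm_real, Real.norm_eq_abs, abs_le]; constructor <;> linarith [hx.1, hx.2]
    push_cast at h1
    calc ‖α + β * (x - 1)‖ ≤ ‖α‖ + ‖β‖ * ‖(x : ℂ) - 1‖ := by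
          rw [← norm_mul]; exact norm_add_le _ _
      _ ≤ (‖α‖ + ‖β‖) * (1 / 2) ^ 0 * 1 := by
          simpa using mul_le_of_le_one_right (norm_nonneg β) h1
      _ ≤ _ := by
          gcongr
          exact Real.one_le_exp (by linarith [hΦ x hx])
  | succ n ih =>
    set M := ‖α‖ + ‖β‖
    have hinner : ∀ t ∈ Icc x 1, ‖∫ s in t..1, ((V s : ℂ) - z) * picardTerm V α β n z s‖ ≤
        M * (1 / 2) ^ (n + 1) * Real.exp (2 * ∫ s in x..1, (|V s| + R)) := by
      intro t ht
      have ht' := mem_Ioc_of_mem_Icc hx ht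
      obtain ⟨hi, he⟩ := integral_mul_exp_integral 2 (hw t ht')
      calc _ ≤ ∫ s in t..1, M * (1 / 2) ^ (n + 1) * (2 * (|V s| + R) *
            Real.exp (2 * ∫ r in s..1, (|V r| + R))) := by
            refine intervalIntegral.norm_integral_le_of_norm_le ht'.2
              (Eventually.of_forall fun s hs => ?_) (hi.const_mul _)
            have hs' : s ∈ Ioc (0 : ℝ) 1 := ⟨ht'.1.trans hs.1, hs.2⟩
            have h1 : ‖(V s : ℂ) - z‖ ≤ |V s| + R := by
              refine (norm_sub_le _ _).trans ?_
              rw [Complex.norm_real, Real.norm_eq_abs]; gcongr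
            rw [norm_mul]
            calc _ ≤ (|V s| + R) * (M * (1 / 2) ^ n * Real.exp (2 * ∫ r in s..1, (|V r| + R))) := by
                  gcongr; exact ih hs'
              _ = _ := by rw [pow_succ]; ring
        _ = M * (1 / 2) ^ (n + 1) * (Real.exp (2 * ∫ r in t..1, (|V r| + R)) - 1) := by
            rw [intervalIntegral.integral_const_mul, he]
        _ ≤ _ := by
            gcongr
            have := Real.exp_le_exp.2 (mul_le_mul_of_nonneg_left (hmono x hx t ht) zero_le_two)
            linarith
    have := intervalIntegral.norm_integral_le_of_norm_le_const (a := x) (b := 1)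
      fun t ht => hinner t (by rw [uIoc_of_le hx.2] at ht; exact ⟨ht.1.le, ht.2⟩)
    refine this.trans (mul_le_of_le_one_right (by positivity) ?_)
    rw [abs_le]; constructor <;> linarith [hx.1, hx.2]

/-- The Picard series is dominated by a geometric series, uniformly on `[x, 1]` and for bounded `z`.
Continuity, termwise integration and holomorphy therefore pass to the sum. Integrability of `V` near
`0` is never needed. -/
theorem exists_entire_solution {V : ℝ → ℝ}
    (hV : ∀ a ∈ Ioc (0 : ℝ) 1, IntervalIntegrable V volume a 1) (α β : ℂ) :
    ∃ u u' : ℂ → ℝ → ℂ,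
      (∀ z, ContinuousOn (u z) (Ioc 0 1)) ∧ (∀ z, ContinuousOn (u' z) (Ioc 0 1)) ∧
      (∀ z, ∀ x ∈ Ioc (0 : ℝ) 1, u z x = α - ∫ t in x..1, u' z t) ∧
      (∀ z, ∀ x, u' z x = β - ∫ t in x..1, ((V t : ℂ) - z) * u z t) ∧
      ∀ x ∈ Ioc (0 : ℝ) 1, Differentiable ℂ fun z => u z x := by
  have hP := polynomialFamily_picardTerm hV α β
  set B : ℝ → ℝ → ℕ → ℝ := fun R x n =>
    (‖α‖ + ‖β‖) * (1 / 2) ^ n * Real.exp (2 * ∫ s in x..1, (|V s| + R)) with hB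
  have hBs : ∀ R x, Summable (B R x) := fun R x =>
    ((summable_geometric_of_lt_one (by norm_num) (by norm_num)).mul_left _).mul_right _
  have hle : ∀ z, ∀ x ∈ Ioc (0 : ℝ) 1, ∀ t ∈ Icc x 1, ∀ n,
      ‖picardTerm V α β n z t‖ ≤ B ‖z‖ x n := by
    intro z x hx t ht n
    refine (norm_picardTerm_le hV α β n le_rfl (mem_Ioc_of_mem_Icc hx ht)).trans ?_
    simp only [hB]
    gcongr 2
    refine mul_le_mul_of_nonneg_left ?_ zero_le_two
    exact intervalIntegral.integral_mono_interval ht.1 ht.2 le_rfl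
      (Eventually.of_forall fun s => by simp only [Pi.zero_apply]; positivity)
      ((hV x hx).abs.add intervalIntegrable_const)
  set u : ℂ → ℝ → ℂ := fun z x => ∑' n, picardTerm V α β n z x with hu
  have hsum : ∀ z, ∀ x ∈ Ioc (0 : ℝ) 1, HasSum (fun n => picardTerm V α β n z x) (u z x) :=
    fun z x hx => (Summable.of_norm_bounded (hBs ‖z‖ x)
      (hle z x hx x (left_mem_Icc.2 hx.2))).hasSum
  have hcont : ∀ z, ContinuousOn (u z) (Ioc 0 1) := by
    intro z x hx
    have hx2 : x / 2 ∈ Ioc (0 : ℝ) 1 := ⟨half_pos hx.1, by linarith [hx.1, hx.2]⟩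
    have : ContinuousOn (u z) (Icc (x / 2) 1) :=
      continuousOn_tsum (fun n => ((hP n).continuousOn z).mono fun t ht =>
        mem_Ioc_of_mem_Icc hx2 ht) (hBs ‖z‖ (x / 2)) fun n t ht => hle z _ hx2 t ht n
    exact (this x ⟨by linarith [hx.1], hx.2⟩).mono_of_mem_nhdsWithin (Icc_mem_nhdsWithin_Ioc hx)
  have hI := fun z => fun t (ht : t ∈ Ioc (0 : ℝ) 1) =>
    intervalIntegrable_potential_mul hV (hcont z) z ht
  have hIc := fun z => continuousOn_integral_right (hI z)
  have hdom : ∀ z, ∀ x ∈ Ioc (0 : ℝ) 1, ∀ s ∈ Icc x 1, ∀ n,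
      ‖((V s : ℂ) - z) * picardTerm V α β n z s‖ ≤ (|V s| + ‖z‖) * B ‖z‖ x n := by
    intro z x hx s hs n
    rw [norm_mul]
    gcongr
    · refine (norm_sub_le _ _).trans ?_
      rw [Complex.norm_real, Real.norm_eq_abs]
    · exact hle z x hx s hs n
  have hinner : ∀ z, ∀ x ∈ Ioc (0 : ℝ) 1,
      HasSum (fun n => ∫ s in x..1, ((V s : ℂ) - z) * picardTerm V α β n z s)
        (∫ s in x..1, ((V s : ℂ) - z) * u z s) := by
    intro z x hx
    have hmem : ∀ t ∈ uIoc x 1, t ∈ Icc x 1 := fun t ht => by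
      rw [uIoc_of_le hx.2] at ht; exact ⟨ht.1.le, ht.2⟩
    refine intervalIntegral.hasSum_integral_of_dominated_convergence
      (fun n s => (|V s| + ‖z‖) * B ‖z‖ x n) (fun n => ?_)
      (fun n => Eventually.of_forall fun s hs => hdom z x hx s (hmem s hs) n)
      (Eventually.of_forall fun s _ => (hBs _ _).mul_left _) ?_
      (Eventually.of_forall fun s hs => (hsum z s (mem_Ioc_of_mem_Icc hx (hmem s hs))).mul_left _)
    · exact (intervalIntegrable_potential_mul hV
        ((hP n).continuousOn z) z hx).aestronglyMeasurable_restrict_uIoc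
    · simp only [tsum_mul_left]
      exact ((hV x hx).abs.add intervalIntegrable_const).mul_const _
  have houter : ∀ z, ∀ x ∈ Ioc (0 : ℝ) 1,
      HasSum (fun n => picardTerm V α β (n + 1) z x)
        (∫ t in x..1, ∫ s in t..1, ((V s : ℂ) - z) * u z s) := by
    intro z x hx
    have hmem : ∀ t ∈ uIoc x 1, t ∈ Icc x 1 := fun t ht => by
      rw [uIoc_of_le hx.2] at ht; exact ⟨ht.1.le, ht.2⟩
    have hw : IntervalIntegrable (fun s => |V s| + ‖z‖) volume x 1 :=
      (hV x hx).abs.add intervalIntegrable_const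
    refine intervalIntegral.hasSum_integral_of_dominated_convergence
      (fun n _ => (∫ s in x..1, (|V s| + ‖z‖)) * B ‖z‖ x n) (fun n => ?_)
      (fun n => Eventually.of_forall fun t ht => ?_)
      (Eventually.of_forall fun t _ => (hBs _ _).mul_left _) intervalIntegrable_const
      (Eventually.of_forall fun t ht => hinner z t (mem_Ioc_of_mem_Icc hx (hmem t ht)))
    · exact (intervalIntegrable_of_continuousOn_Ioc (continuousOn_integral_right fun t ht =>
        intervalIntegrable_potential_mul hV ((hP n).continuousOn z) z ht)
          hx).aestronglyMeasurable_restrict_uIoc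
    · have ht' := hmem t ht
      rw [← intervalIntegral.integral_mul_const]
      refine (intervalIntegral.norm_integral_le_of_norm_le ht'.2
        (Eventually.of_forall fun s hs => hdom z x hx s ⟨ht'.1.trans hs.1.le, hs.2⟩ n)
        ((hw.mono_set ?_).mul_const _)).trans ?_
      · rw [uIcc_of_le ht'.2, uIcc_of_le hx.2]; exact Icc_subset_Icc_left ht'.1
      · refine intervalIntegral.integral_mono_interval ht'.1 ht'.2 le_rfl
          (Eventually.of_forall fun s => ?_) (hw.mul_const _)
        simp only [Pi.zero_apply, hB]; positivity
  refine ⟨u, fun z x => β - ∫ t in x..1, ((V t : ℂ) - z) * u z t, hcont,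
    fun z => continuousOn_const.sub (hIc z), fun z x hx => ?_, fun _ _ => rfl, fun x hx => ?_⟩
  -- The terms from index `1` on sum to the double integral; the affine term of index `0` supplies
  -- the Cauchy data.
  · have h1 := (hasSum_nat_add_iff (f := fun n => picardTerm V α β n z x) 1).1 (houter z x hx)
    rw [Finset.sum_range_one] at h1
    rw [(hsum z x hx).unique h1, intervalIntegral.integral_sub intervalIntegrable_const
      (intervalIntegrable_of_continuousOn_Ioc (hIc z) hx), intervalIntegral.integral_const]
    simp only [picardTerm, Complex.real_smul]
    push_cast
    ring
  · intro z
    have hd : ∀ n, DifferentiableOn ℂ (fun z => picardTerm V α β n z x)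
        (Metric.ball 0 (‖z‖ + 1)) := fun n => ((hP n).differentiable hx).differentiableOn
    have hn : ∀ n, ∀ w ∈ Metric.ball (0 : ℂ) (‖z‖ + 1),
        ‖picardTerm V α β n w x‖ ≤ B (‖z‖ + 1) x n :=
      fun n w hw => norm_picardTerm_le hV α β n (mem_ball_zero_iff.1 hw).le hx
    have h1 := Complex.differentiableOn_tsum_of_summable_norm (hBs (‖z‖ + 1) x) hd
      Metric.isOpen_ball hn
    exact h1.differentiableAt (Metric.isOpen_ball.mem_nhds (by simp))

/-! ### Entire power series -/

/-- The power series with coefficients `a` has infinite radius of convergence. -/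
def EntireCoeff (a : ℕ → ℂ) : Prop := ∀ r : ℝ, 0 ≤ r → Summable fun k => ‖a k‖ * r ^ k

/-- The sum of the power series with coefficients `a`. -/
noncomputable def powerSum (a : ℕ → ℂ) (t : ℂ) : ℂ := ∑' k, a k * t ^ k

/-- The coefficients of the derivative of a power series. -/
def derivCoeff (a : ℕ → ℂ) (k : ℕ) : ℂ := (k + 1) * a (k + 1)

theorem EntireCoeff.hasSum {a : ℕ → ℂ} (ha : EntireCoeff a) (t : ℂ) :
    HasSum (fun k => a k * t ^ k) (powerSum a t) :=
  (Summable.of_norm (by simpa using ha ‖t‖ (norm_nonneg t))).hasSum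

/-- Factors growing like `2^k` amount to replacing `r` by `2 r`, which is harmless when all radii
are allowed. -/
theorem EntireCoeff.mul_of_le {a : ℕ → ℂ} (ha : EntireCoeff a) {b : ℕ → ℂ} {C : ℝ}
    (hb : ∀ k, ‖b k‖ ≤ C * 2 ^ k) : EntireCoeff fun k => b k * a k := by
  intro r hr
  refine Summable.of_nonneg_of_le (fun k => by positivity) (fun k => ?_)
    ((ha (2 * r) (by positivity)).mul_left C)
  rw [norm_mul, mul_pow]
  calc _ ≤ C * 2 ^ k * ‖a k‖ * r ^ k := by gcongr; exact hb k
    _ = _ := by ring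

theorem EntireCoeff.of_nat_add {a : ℕ → ℂ} (n : ℕ) (ha : EntireCoeff fun k => a (k + n)) :
    EntireCoeff a := by
  intro r hr
  rw [← summable_nat_add_iff n]
  refine ((ha r hr).mul_right (r ^ n)).congr fun k => ?_
  rw [pow_add]; ring

theorem EntireCoeff.succ {a : ℕ → ℂ} (ha : EntireCoeff a) : EntireCoeff fun k => a (k + 1) := by
  intro r hr
  have h := (summable_nat_add_iff 1).2 (ha (max r 1) (by positivity))
  refine Summable.of_nonneg_of_le (fun k => by positivity) (fun k => ?_) h
  gcongr
  calc r ^ k ≤ (max r 1) ^ k := by gcongr; exact le_max_left _ _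
    _ ≤ _ := pow_le_pow_right₀ (le_max_right _ _) (Nat.le_succ k)

theorem norm_natCast_le (k : ℕ) : ‖(k : ℂ)‖ ≤ 1 * 2 ^ k := by
  rw [Complex.norm_natCast, one_mul]
  exact_mod_cast Nat.lt_two_pow_self.le

theorem EntireCoeff.natCast_mul {a : ℕ → ℂ} (ha : EntireCoeff a) :
    EntireCoeff fun k => (k : ℂ) * a k := ha.mul_of_le norm_natCast_le

theorem EntireCoeff.const_mul {a : ℕ → ℂ} (ha : EntireCoeff a) (c : ℂ) :
    EntireCoeff fun k => c * a k :=
  ha.mul_of_le (C := ‖c‖) fun _ =>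
    le_mul_of_one_le_right (norm_nonneg c) (one_le_pow₀ one_le_two)

theorem EntireCoeff.deriv {a : ℕ → ℂ} (ha : EntireCoeff a) : EntireCoeff (derivCoeff a) := by
  have := ha.natCast_mul.succ
  push_cast at this
  exact this

theorem EntireCoeff.of_ratio {a : ℕ → ℂ} (h : ∀ᶠ k : ℕ in atTop, ‖a (k + 1)‖ * (k + 1) ≤ ‖a k‖) :
    EntireCoeff a := by
  intro r hr
  refine summable_of_ratio_norm_eventually_le (r := 1 / 2) (by norm_num) ?_
  filter_upwards [h, eventually_ge_atTop ⌈2 * r⌉₊] with k hk hkr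
  have hkr' : 2 * r ≤ k := (Nat.le_ceil _).trans (by exact_mod_cast hkr)
  have hr2 : r ≤ 1 / 2 * (k + 1) := by linarith
  rw [Real.norm_of_nonneg (by positivity), Real.norm_of_nonneg (by positivity), pow_succ]
  calc ‖a (k + 1)‖ * (r ^ k * r) ≤ ‖a (k + 1)‖ * (r ^ k * (1 / 2 * (k + 1))) := by gcongr
    _ = 1 / 2 * ((‖a (k + 1)‖ * (k + 1)) * r ^ k) := by ring
    _ ≤ _ := by gcongr

/-- Once `k ≥ -μ`, the factor `k + 1 + μ` is at least `1`, so the remaining factor `k + 1` forces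
factorial decay. -/
theorem EntireCoeff.of_recurrence {a : ℕ → ℂ} {μ : ℝ}
    (h : ∀ k : ℕ, ((k : ℂ) + 1) * (k + 1 + μ) * a (k + 1) = -a k) : EntireCoeff a := by
  refine .of_ratio ?_
  filter_upwards [eventually_ge_atTop ⌈-μ⌉₊] with k hk
  have hk' : -μ ≤ k := (Nat.le_ceil _).trans (by exact_mod_cast hk)
  have h1 : ‖((k : ℂ) + 1) * (k + 1 + μ)‖ = ((k : ℝ) + 1) * (k + 1 + μ) := by
    rw [show ((k : ℂ) + 1) * (k + 1 + μ) = (((k : ℝ) + 1) * (k + 1 + μ) : ℝ) by push_cast; rfl,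
      Complex.norm_real, Real.norm_of_nonneg]
    exact mul_nonneg (by positivity) (by linarith)
  rw [← norm_neg (a k), ← h k, norm_mul, h1, mul_comm]
  gcongr
  nlinarith [(Nat.cast_nonneg k : (0 : ℝ) ≤ k)]

theorem EntireCoeff.powerSum_eq {a : ℕ → ℂ} (ha : EntireCoeff a) (t : ℂ) :
    powerSum a t = a 0 + t * powerSum (fun k => a (k + 1)) t := by
  have h0 : HasSum (fun k => a (k + 1) * t ^ (k + 1)) (t * powerSum (fun k => a (k + 1)) t) :=
    ((ha.succ.hasSum t).mul_left t).congr_fun fun k => by rw [pow_succ]; ring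
  have h := (hasSum_nat_add_iff (f := fun k => a k * t ^ k) 1).1 h0
  rw [(ha.hasSum t).unique h]
  simp [add_comm]

theorem EntireCoeff.hasDerivAt {a : ℕ → ℂ} (ha : EntireCoeff a) (t : ℂ) :
    HasDerivAt (powerSum a) (powerSum (derivCoeff a) t) t := by
  have hF : ∀ k, DifferentiableOn ℂ (fun w : ℂ => a k * w ^ k) (Metric.ball 0 (‖t‖ + 1)) :=
    fun k => by fun_prop
  have hle : ∀ k, ∀ w ∈ Metric.ball (0 : ℂ) (‖t‖ + 1),
      ‖a k * w ^ k‖ ≤ ‖a k‖ * (‖t‖ + 1) ^ k := fun k w hw => by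
    rw [norm_mul, norm_pow]; gcongr; exact (mem_ball_zero_iff.1 hw).le
  have hs := ha (‖t‖ + 1) (by positivity)
  have ht : t ∈ Metric.ball (0 : ℂ) (‖t‖ + 1) := by simp
  have h1 := Complex.differentiableOn_tsum_of_summable_norm hs hF Metric.isOpen_ball hle
  have h2 := Complex.hasSum_deriv_of_summable_norm hs hF Metric.isOpen_ball hle ht
  have h3 := (h1.differentiableAt (Metric.isOpen_ball.mem_nhds ht)).hasDerivAt
  have h0 : HasSum (fun k => _root_.deriv (fun w : ℂ => a (k + 1) * w ^ (k + 1)) t)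
      (powerSum (derivCoeff a) t) := (ha.deriv.hasSum t).congr_fun fun k => by
    simp [derivCoeff]; ring
  have h4 := (hasSum_nat_add_iff (f := fun k => _root_.deriv (fun w : ℂ => a k * w ^ k) t) 1).1 h0
  rw [h2.unique h4] at h3
  simpa using! h3

theorem EntireCoeff.continuous {a : ℕ → ℂ} (ha : EntireCoeff a) : Continuous (powerSum a) :=
  continuous_iff_continuousAt.2 fun t => (ha.hasDerivAt t).continuousAt

theorem powerSum_zero (a : ℕ → ℂ) : powerSum a 0 = a 0 := by
  rw [powerSum, tsum_eq_single 0 fun k hk => by simp [hk]]; simp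

theorem EntireCoeff.mul_powerSum_deriv_deriv {a : ℕ → ℂ} (ha : EntireCoeff a) (t : ℂ) :
    t * powerSum (derivCoeff (derivCoeff a)) t = powerSum (fun k => k * derivCoeff a k) t := by
  rw [ha.deriv.natCast_mul.powerSum_eq t]
  simp only [CharP.cast_eq_zero, zero_mul, zero_add]
  congr 2
  ext k
  simp [derivCoeff]

/-- The differential equation `t A'' + (1 + μ) A' + A + g = 0` in terms of coefficients. -/
theorem EntireCoeff.ode {a g : ℕ → ℂ} (ha : EntireCoeff a) (hg : EntireCoeff g) {μ : ℂ}
    (h : ∀ k : ℕ, ((k : ℂ) + 1) * (k + 1 + μ) * a (k + 1) + a k + g k = 0) (t : ℂ) :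
    t * powerSum (derivCoeff (derivCoeff a)) t + (1 + μ) * powerSum (derivCoeff a) t
      + powerSum a t + powerSum g t = 0 := by
  rw [ha.mul_powerSum_deriv_deriv]
  refine ((((ha.deriv.natCast_mul.hasSum t).add ((ha.deriv.hasSum t).mul_left (1 + μ))).add
    (ha.hasSum t)).add (hg.hasSum t)).unique (hasSum_zero.congr_fun fun k => ?_)
  rw [derivCoeff]
  linear_combination t ^ k * h k

/-! ### Frobenius solutions of the free equation -/

/-- The function `x^{1/2+μ} (A(t) + log(x/2) B(t))` with `t = z x² / 4`, where `A`, `B` are the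
power series with coefficients `a`, `b`. -/
noncomputable def frobenius (μ : ℝ) (a b : ℕ → ℂ) (z : ℂ) (x : ℝ) : ℂ :=
  ((x ^ (μ + 1 / 2) : ℝ) : ℂ) *
    (powerSum a (z * x ^ 2 / 4) + (Real.log (x / 2) : ℂ) * powerSum b (z * x ^ 2 / 4))

/-- The bracket in the derivative `x^{μ-1/2} [...]` of `frobenius`. -/
noncomputable def frobeniusBracket (μ : ℝ) (a b : ℕ → ℂ) (z : ℂ) (x : ℝ) : ℂ :=
  (μ + 1 / 2) *
    (powerSum a (z * x ^ 2 / 4) + (Real.log (x / 2) : ℂ) * powerSum b (z * x ^ 2 / 4)) +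
  2 * (z * x ^ 2 / 4) * (powerSum (derivCoeff a) (z * x ^ 2 / 4) +
    (Real.log (x / 2) : ℂ) * powerSum (derivCoeff b) (z * x ^ 2 / 4)) +
  powerSum b (z * x ^ 2 / 4)

/-- The derivative of `frobenius` with respect to `x`. -/
noncomputable def frobeniusDeriv (μ : ℝ) (a b : ℕ → ℂ) (z : ℂ) (x : ℝ) : ℂ :=
  ((x ^ (μ - 1 / 2) : ℝ) : ℂ) * frobeniusBracket μ a b z x

theorem EntireCoeff.hasDerivAt_comp_sq {a : ℕ → ℂ} (ha : EntireCoeff a) (z : ℂ) {x : ℝ}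
    (hx : 0 < x) :
    HasDerivAt (fun x : ℝ => powerSum a (z * x ^ 2 / 4))
      (powerSum (derivCoeff a) (z * x ^ 2 / 4) * (2 * (z * x ^ 2 / 4) / x)) x := by
  refine HasDerivAt.comp (h := fun x : ℝ => z * (x : ℂ) ^ 2 / 4) x (ha.hasDerivAt (z * x ^ 2 / 4)) ?_
  have h : HasDerivAt (fun w : ℂ => z * w ^ 2 / 4) (z * (2 * (x : ℂ)) / 4) (x : ℂ) := by
    simpa using (((hasDerivAt_id (x : ℂ)).pow 2).const_mul z).div_const 4
  have hx' : (x : ℂ) ≠ 0 := by exact_mod_cast hx.ne'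
  refine h.comp_ofReal.congr_deriv ?_
  field_simp

theorem hasDerivAt_ofReal_log_half {x : ℝ} (hx : 0 < x) :
    HasDerivAt (fun x : ℝ => (Real.log (x / 2) : ℂ)) (1 / (x : ℂ)) x := by
  have h : HasDerivAt (fun x : ℝ => Real.log (x / 2)) (1 / x) x := by
    refine (((hasDerivAt_id' x).div_const 2).log (by simpa using hx.ne')).congr_deriv ?_
    field_simp
  exact_mod_cast h.ofReal_comp

theorem hasDerivAt_ofReal_rpow {x : ℝ} (hx : 0 < x) (p : ℝ) :
    HasDerivAt (fun x : ℝ => ((x ^ p : ℝ) : ℂ)) (p * ((x ^ p : ℝ) : ℂ) / x) x := by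
  have h := (Real.hasDerivAt_rpow_const (p := p) (Or.inl hx.ne')).ofReal_comp
  convert h using 1
  rw [Real.rpow_sub_one hx.ne']
  push_cast
  ring

theorem hasDerivAt_frobenius {μ : ℝ} {a b : ℕ → ℂ} (ha : EntireCoeff a) (hb : EntireCoeff b)
    (z : ℂ) {x : ℝ} (hx : 0 < x) :
    HasDerivAt (frobenius μ a b z) (frobeniusDeriv μ a b z x) x := by
  have hx' : (x : ℂ) ≠ 0 := by exact_mod_cast hx.ne'
  have h := (hasDerivAt_ofReal_rpow hx (μ + 1 / 2)).mul ((ha.hasDerivAt_comp_sq z hx).add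
    ((hasDerivAt_ofReal_log_half hx).mul (hb.hasDerivAt_comp_sq z hx)))
  refine h.congr_deriv ?_
  have he : x ^ (μ + 1 / 2) = x ^ (μ - 1 / 2) * x := by
    rw [← Real.rpow_add_one hx.ne']; congr 1; ring
  simp only [frobeniusDeriv, frobeniusBracket, Pi.add_apply, Pi.mul_apply]
  rw [he]
  push_cast
  generalize powerSum a _ = A, powerSum (derivCoeff a) _ = A1, powerSum b _ = B,
    powerSum (derivCoeff b) _ = B1
  field_simp
  ring

/-- Inserting the ansatz and separating the part with the logarithm from the part without it gives
`t B'' + (1 + μ) B' + B = 0` and the same equation for `A` with the source `(μ/2) B / t + B'`. The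
condition `μ b 0 = 0` removes the pole of that source at `t = 0`. -/
theorem hasDerivAt_frobeniusDeriv {μ : ℝ} {a b : ℕ → ℂ} (ha : EntireCoeff a) (hb : EntireCoeff b)
    (hb0 : (μ : ℂ) * b 0 = 0)
    (hbr : ∀ k : ℕ, ((k : ℂ) + 1) * (k + 1 + μ) * b (k + 1) + b k = 0)
    (har : ∀ k : ℕ, ((k : ℂ) + 1) * (k + 1 + μ) * a (k + 1) + a k +
      (μ / 2 + k + 1) * b (k + 1) = 0)
    (z : ℂ) {x : ℝ} (hx : 0 < x) :
    HasDerivAt (frobeniusDeriv μ a b z)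
      ((((μ ^ 2 - 1 / 4) / x ^ 2 : ℝ) - z) * frobenius μ a b z x) x := by
  have hx' : (x : ℂ) ≠ 0 := by exact_mod_cast hx.ne'
  have hzero : EntireCoeff fun _ => 0 := fun r _ => by simp
  -- These are the coefficients of the source, with `B / t` replaced by `(B - b 0) / t`.
  have hg : EntireCoeff fun k => ((μ : ℂ) / 2) * b (k + 1) + derivCoeff b k := by
    intro r hr
    refine Summable.of_nonneg_of_le (fun k => by positivity) (fun k => ?_)
      ((hb.succ.const_mul ((μ : ℂ) / 2) r hr).add (hb.deriv r hr))
    rw [← add_mul]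
    gcongr
    exact norm_add_le _ _
  set t : ℂ := z * x ^ 2 / 4 with ht
  have hz : z = 4 * t / (x : ℂ) ^ 2 := by rw [ht]; field_simp
  have hA := ha.ode hg (μ := μ) (fun k => by rw [derivCoeff]; linear_combination har k) t
  have hB := hb.ode hzero (μ := μ) (fun k => by linear_combination hbr k) t
  have hG : powerSum (fun k => ((μ : ℂ) / 2) * b (k + 1) + derivCoeff b k) t =
      (μ : ℂ) / 2 * powerSum (fun k => b (k + 1)) t + powerSum (derivCoeff b) t :=
    (hg.hasSum t).unique ((((hb.succ.hasSum t).mul_left ((μ : ℂ) / 2)).add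
      (hb.deriv.hasSum t)).congr_fun fun k => by ring)
  have hB0 : powerSum (fun _ => 0) t = 0 := by simp [powerSum]
  have hBs := hb.powerSum_eq t
  have hd2 : HasDerivAt (fun x : ℝ => 2 * (z * (x : ℂ) ^ 2 / 4)) (4 * t / x) x := by
    have h : HasDerivAt (fun w : ℂ => 2 * (z * w ^ 2 / 4)) (2 * (z * (2 * (x : ℂ)) / 4)) (x : ℂ) := by
      simpa using ((((hasDerivAt_id (x : ℂ)).pow 2).const_mul z).div_const 4).const_mul 2
    convert h.comp_ofReal using 1
    rw [ht]; field_simp; ring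
  have hL := hasDerivAt_ofReal_log_half hx
  have h := (hasDerivAt_ofReal_rpow hx (μ - 1 / 2)).mul
    (((((ha.hasDerivAt_comp_sq z hx).add (hL.mul (hb.hasDerivAt_comp_sq z hx))).const_mul
      ((μ : ℂ) + 1 / 2)).add (hd2.mul ((ha.deriv.hasDerivAt_comp_sq z hx).add
        (hL.mul (hb.deriv.hasDerivAt_comp_sq z hx))))).add (hb.hasDerivAt_comp_sq z hx))
  refine h.congr_deriv ?_
  have he : x ^ (μ + 1 / 2) = x ^ (μ - 1 / 2) * x := by
    rw [← Real.rpow_add_one hx.ne']; congr 1; ring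
  simp only [frobenius, Pi.add_apply, Pi.mul_apply, ← ht]
  rw [he, hz]
  rw [hG] at hA
  rw [hB0] at hB
  clear h hG hB0
  push_cast
  generalize powerSum a t = A at *
  generalize powerSum (derivCoeff a) t = A1 at *
  generalize powerSum (derivCoeff (derivCoeff a)) t = A2 at *
  generalize powerSum b t = B at *
  generalize powerSum (derivCoeff b) t = B1 at *
  generalize powerSum (derivCoeff (derivCoeff b)) t = B2 at *
  generalize powerSum (fun k => b (k + 1)) t = B' at *
  generalize (((x ^ (μ - 1 / 2) : ℝ) : ℂ)) = X
  generalize ((Real.log (x / 2) : ℝ) : ℂ) = L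
  clear_value t
  field_simp
  linear_combination 64 * X * t * hA + 64 * X * t * L * hB + 32 * X * μ * hBs + 32 * X * hb0

/-- `f`, with derivative `f'`, solves `f'' = (l(l+1)/x² - z) f` on `(0,∞)`. -/
structure IsFreeSolution (l : ℝ) (z : ℂ) (f f' : ℝ → ℂ) : Prop where
  hasDerivAt : ∀ x, 0 < x → HasDerivAt f (f' x) x
  hasDerivAt_deriv : ∀ x, 0 < x → HasDerivAt f' (((l * (l + 1) / x ^ 2 : ℝ) - z) * f x) x

theorem IsFreeSolution.wronskian_eq {l : ℝ} {z : ℂ} {f f' g g' : ℝ → ℂ}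
    (hf : IsFreeSolution l z f f') (hg : IsFreeSolution l z g g') {x y : ℝ} (hx : 0 < x)
    (hy : 0 < y) : f x * g' x - f' x * g x = f y * g' y - f' y * g y := by
  have hd : ∀ x ∈ Ioi (0 : ℝ), HasDerivAt (fun x => f x * g' x - f' x * g x) 0 x := by
    intro x hx
    refine (((hf.hasDerivAt x hx).mul (hg.hasDerivAt_deriv x hx)).sub
      ((hf.hasDerivAt_deriv x hx).mul (hg.hasDerivAt x hx))).congr_deriv ?_
    ring
  exact isOpen_Ioi.is_const_of_deriv_eq_zero isPreconnected_Ioi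
    (fun x hx => (hd x hx).differentiableAt.differentiableWithinAt)
    (fun x hx => (hd x hx).deriv) hx hy

theorem tendsto_log_half_mul_sq (z : ℂ) :
    Tendsto (fun x : ℝ => (Real.log (x / 2) : ℂ) * (z * x ^ 2 / 4)) (𝓝[>] 0) (𝓝 0) := by
  have h1 : Tendsto (fun x : ℝ => x / 2) (𝓝[>] 0) (𝓝[>] 0) := by
    refine tendsto_nhdsWithin_iff.2 ⟨?_, ?_⟩
    · have : Tendsto (fun x : ℝ => x / 2) (𝓝 0) (𝓝 (0 / 2)) := tendsto_id.div_const 2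
      rw [zero_div] at this
      exact this.mono_left nhdsWithin_le_nhds
    · filter_upwards [self_mem_nhdsWithin] with x hx using half_pos (mem_Ioi.1 hx)
  have h2 := (tendsto_log_mul_rpow_nhdsGT_zero two_pos).comp h1
  have h3 := ((Complex.continuous_ofReal.tendsto _).comp h2).mul_const z
  simp only [Complex.ofReal_zero, zero_mul] at h3
  refine h3.congr fun x => ?_
  simp only [Function.comp_apply, Real.rpow_two]
  push_cast
  ring

theorem EntireCoeff.tendsto_comp_sq {a : ℕ → ℂ} (ha : EntireCoeff a) (z : ℂ) :
    Tendsto (fun x : ℝ => powerSum a (z * x ^ 2 / 4)) (𝓝[>] 0) (𝓝 (a 0)) := by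
  have h : Continuous fun x : ℝ => powerSum a (z * x ^ 2 / 4) :=
    ha.continuous.comp (by fun_prop)
  have := h.tendsto 0
  simp only [Complex.ofReal_zero, ne_eq, OfNat.ofNat_ne_zero, not_false_eq_true, zero_pow,
    mul_zero, zero_div, powerSum_zero] at this
  exact this.mono_left nhdsWithin_le_nhds

/-- Coefficients of a pair of Frobenius solutions with exponents `1/2 ± ν`. -/
structure FrobeniusPair (ν : ℝ) (a c b : ℕ → ℂ) : Prop where
  entire_a : EntireCoeff a
  entire_c : EntireCoeff c
  entire_b : EntireCoeff b
  rec_a : ∀ k : ℕ, ((k : ℂ) + 1) * (k + 1 + ν) * a (k + 1) + a k = 0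
  rec_b : ∀ k : ℕ, ((k : ℂ) + 1) * (k + 1 - ν) * b (k + 1) + b k = 0
  rec_c : ∀ k : ℕ, ((k : ℂ) + 1) * (k + 1 - ν) * c (k + 1) + c k +
    (-ν / 2 + k + 1) * b (k + 1) = 0
  mul_b_zero : (ν : ℂ) * b 0 = 0
  wronskian : a 0 * (2 * ν * c 0 - b 0) = 1

theorem entireCoeff_zero : EntireCoeff 0 := fun r _ => by simp

theorem powerSum_zero_coeff (t : ℂ) : powerSum 0 t = 0 := by simp [powerSum]

theorem derivCoeff_zero : derivCoeff 0 = 0 := by ext k; simp [derivCoeff]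

theorem FrobeniusPair.isFreeSolution_left {ν : ℝ} {a c b : ℕ → ℂ} (h : FrobeniusPair ν a c b)
    {l : ℝ} (hl : ν = l + 1 / 2) (z : ℂ) :
    IsFreeSolution l z (frobenius ν a 0 z) (frobeniusDeriv ν a 0 z) where
  hasDerivAt x hx := hasDerivAt_frobenius h.entire_a entireCoeff_zero z hx
  hasDerivAt_deriv x hx := by
    have := hasDerivAt_frobeniusDeriv (μ := ν) h.entire_a entireCoeff_zero (by simp)
      (by simp) (by simpa using h.rec_a) z hx
    rwa [show ν ^ 2 - 1 / 4 = l * (l + 1) by rw [hl]; ring] at this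

theorem FrobeniusPair.isFreeSolution_right {ν : ℝ} {a c b : ℕ → ℂ} (h : FrobeniusPair ν a c b)
    {l : ℝ} (hl : ν = l + 1 / 2) (z : ℂ) :
    IsFreeSolution l z (frobenius (-ν) c b z) (frobeniusDeriv (-ν) c b z) where
  hasDerivAt x hx := hasDerivAt_frobenius h.entire_c h.entire_b z hx
  hasDerivAt_deriv x hx := by
    have := hasDerivAt_frobeniusDeriv (μ := -ν) h.entire_c h.entire_b
      (by push_cast; linear_combination -h.mul_b_zero)
      (fun k => by push_cast; linear_combination h.rec_b k)
      (fun k => by push_cast; linear_combination h.rec_c k) z hx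
    rwa [show (-ν) ^ 2 - 1 / 4 = l * (l + 1) by rw [hl]; ring] at this

/-- The Wronskian does not depend on `x`, so it equals its limit at `0`, where the powers of `x`
cancel and only the leading coefficients remain. -/
theorem FrobeniusPair.wronskian_eq_one {ν : ℝ} {a c b : ℕ → ℂ} (h : FrobeniusPair ν a c b)
    (z : ℂ) {x : ℝ} (hx : 0 < x) :
    frobenius (-ν) c b z x * frobeniusDeriv ν a 0 z x
      - frobeniusDeriv (-ν) c b z x * frobenius ν a 0 z x = 1 := by
  have hl : ν = (ν - 1 / 2) + 1 / 2 := by ring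
  have hW := fun y (hy : 0 < y) =>
    (h.isFreeSolution_right hl z).wronskian_eq (h.isFreeSolution_left hl z) hx hy
  set W := frobenius (-ν) c b z x * frobeniusDeriv ν a 0 z x
      - frobeniusDeriv (-ν) c b z x * frobenius ν a 0 z x
  have hA := h.entire_a.tendsto_comp_sq z
  have hA1 := h.entire_a.deriv.tendsto_comp_sq z
  have hC := h.entire_c.tendsto_comp_sq z
  have hC1 := h.entire_c.deriv.tendsto_comp_sq z
  have hB := h.entire_b.tendsto_comp_sq z
  have hB1 := h.entire_b.deriv.tendsto_comp_sq z
  have hBs := h.entire_b.succ.tendsto_comp_sq z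
  have hL := tendsto_log_half_mul_sq z
  have ht : Tendsto (fun x : ℝ => z * (x : ℂ) ^ 2 / 4) (𝓝[>] 0) (𝓝 0) := by
    have : Continuous fun x : ℝ => z * (x : ℂ) ^ 2 / 4 := by fun_prop
    simpa using (this.tendsto 0).mono_left nhdsWithin_le_nhds
  -- This is the Wronskian after writing `B = b 0 + t (...)` in its term `2 ν A B log(x/2)`. Since
  -- `ν b 0 = 0`, every logarithm is accompanied by a factor `t`, and the product tends to `0`.
  have key := ((((hA.mul hC).const_mul (2 * (ν : ℂ))).sub (hA.mul hB)).add (hL.mul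
    ((((hA.mul hBs).const_mul (2 * (ν : ℂ))).add ((hB.mul hA1).const_mul 2)).sub
      ((hA.mul hB1).const_mul 2)))).add
    ((ht.mul ((hC.mul hA1).sub (hA.mul hC1))).const_mul 2)
  simp only [zero_mul, mul_zero, add_zero] at key
  have hlim : Tendsto (fun _ : ℝ => W) (𝓝[>] 0) (𝓝 (2 * ν * (a 0 * c 0) - a 0 * b 0)) := by
    refine key.congr' ?_
    filter_upwards [self_mem_nhdsWithin] with y hy
    rw [hW y hy]
    have hy0 : y ≠ 0 := (ne_of_gt hy)
    have e1 : ((y ^ (-ν + 1 / 2) : ℝ) : ℂ) * ((y ^ (ν - 1 / 2) : ℝ) : ℂ) = 1 := by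
      rw [← Complex.ofReal_mul, ← Real.rpow_add hy]; simp
    have e2 : ((y ^ (-ν - 1 / 2) : ℝ) : ℂ) * ((y ^ (ν + 1 / 2) : ℝ) : ℂ) = 1 := by
      rw [← Complex.ofReal_mul, ← Real.rpow_add hy]
      norm_num
    have e3 := h.entire_b.powerSum_eq (z * (y : ℂ) ^ 2 / 4)
    simp only [frobenius, frobeniusDeriv, frobeniusBracket, derivCoeff_zero, powerSum_zero_coeff,
      mul_zero, add_zero]
    push_cast
    linear_combination (exp := 1)
      (-(powerSum c (z * y ^ 2 / 4) + (Real.log (y / 2) : ℂ) * powerSum b (z * y ^ 2 / 4)) *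
        ((ν + 1 / 2) * powerSum a (z * y ^ 2 / 4) +
          2 * (z * y ^ 2 / 4) * powerSum (derivCoeff a) (z * y ^ 2 / 4))) * e1 +
      ((-ν + 1 / 2) * (powerSum c (z * y ^ 2 / 4) +
          (Real.log (y / 2) : ℂ) * powerSum b (z * y ^ 2 / 4)) +
        2 * (z * y ^ 2 / 4) * (powerSum (derivCoeff c) (z * y ^ 2 / 4) +
          (Real.log (y / 2) : ℂ) * powerSum (derivCoeff b) (z * y ^ 2 / 4)) +
        powerSum b (z * y ^ 2 / 4)) * powerSum a (z * y ^ 2 / 4) * e2 -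
      2 * ν * (Real.log (y / 2) : ℂ) * powerSum a (z * y ^ 2 / 4) * e3 -
      2 * (Real.log (y / 2) : ℂ) * powerSum a (z * y ^ 2 / 4) * h.mul_b_zero
  rw [tendsto_nhds_unique tendsto_const_nhds hlim, ← h.wronskian]
  ring

/-! ### The Bessel functions as Frobenius solutions -/

/-- The coefficients of `∑ₖ (-1)^k t^k / (k! Γ(ν+k+1))`. -/
noncomputable def besselCoeff (ν : ℝ) (k : ℕ) : ℂ :=
  (-1) ^ k / ((k.factorial : ℂ) * Complex.Gamma ((ν : ℂ) + k + 1))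

/-- The functional equation is used for `1 / Γ`, where it also holds at the poles of `Γ`; no order
has to be excluded. -/
theorem besselCoeff_succ (ν : ℝ) (k : ℕ) :
    ((k : ℂ) + 1) * (k + 1 + ν) * besselCoeff ν (k + 1) + besselCoeff ν k = 0 := by
  have h := Complex.one_div_Gamma_eq_self_mul_one_div_Gamma_add_one ((ν : ℂ) + k + 1)
  have hk : (k.factorial : ℂ) ≠ 0 := by exact_mod_cast k.factorial_ne_zero
  have hk1 : (k : ℂ) + 1 ≠ 0 := by exact_mod_cast k.succ_ne_zero
  simp only [besselCoeff, div_eq_mul_inv, mul_inv, h, Nat.factorial_succ, pow_succ]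
  push_cast
  rw [show (ν : ℂ) + (k + 1) + 1 = ν + k + 1 + 1 by ring]
  field_simp
  ring

theorem entireCoeff_besselCoeff (ν : ℝ) : EntireCoeff (besselCoeff ν) :=
  .of_recurrence (μ := ν) fun k => by linear_combination besselCoeff_succ ν k

theorem csqrt_sq (z : ℂ) : csqrt z ^ 2 = z := by
  rw [csqrt, ← Complex.cpow_nat_mul]
  norm_num

theorem csqrt_ne_zero {z : ℂ} (hz : z ≠ 0) : csqrt z ≠ 0 := fun h => hz (by
  rw [← csqrt_sq z, h]; simp)

theorem log_csqrt {z : ℂ} (hz : z ≠ 0) : Complex.log (csqrt z) = Complex.log z / 2 := by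
  rw [csqrt, Complex.cpow_def_of_ne_zero hz, Complex.log_exp]
  · ring
  · simp; linarith [Complex.neg_pi_lt_log_im z, Real.pi_pos]
  · simp; linarith [Complex.log_im_le_pi z, Real.pi_pos]

theorem log_csqrt_mul_half {z : ℂ} (hz : z ≠ 0) {x : ℝ} (hx : 0 < x) :
    Complex.log (csqrt z * x / 2) = Complex.log z / 2 + Real.log (x / 2) := by
  rw [mul_div_assoc, show (x : ℂ) / 2 = ((x / 2 : ℝ) : ℂ) by push_cast; rfl,
    Complex.log_mul_ofReal _ (by positivity) _ (csqrt_ne_zero hz), log_csqrt hz, add_comm]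

theorem half_sq_csqrt (z : ℂ) (x : ℝ) : (csqrt z * x / 2) ^ 2 = z * x ^ 2 / 4 := by
  rw [div_pow, mul_pow, csqrt_sq]; norm_num

/-- Since `x / 2` is positive and `log √z = (log z) / 2` on the principal branch, the power splits
without a branch correction. The factor in `z` then cancels the prefactors of `φ_l` and `θ_l`
exactly. -/
theorem cpow_csqrt_mul_half {z : ℂ} (hz : z ≠ 0) {x : ℝ} (hx : 0 < x) (ν : ℝ) :
    (csqrt z * x / 2) ^ (ν : ℂ) = z ^ ((ν / 2 : ℝ) : ℂ) * (((x / 2) ^ ν : ℝ) : ℂ) := by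
  have h2 : csqrt z * x / 2 ≠ 0 :=
    div_ne_zero (mul_ne_zero (csqrt_ne_zero hz) (by exact_mod_cast hx.ne')) two_ne_zero
  rw [Complex.cpow_def_of_ne_zero h2, Complex.cpow_def_of_ne_zero hz, log_csqrt_mul_half hz hx,
    Real.rpow_def_of_pos (by positivity), Complex.ofReal_exp, ← Complex.exp_add]
  push_cast
  ring_nf

theorem besselJ_csqrt {z : ℂ} (hz : z ≠ 0) {x : ℝ} (hx : 0 < x) (ν : ℝ) :
    besselJ ν (csqrt z * x) = z ^ ((ν / 2 : ℝ) : ℂ) * (((x / 2) ^ ν : ℝ) : ℂ) *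
      powerSum (besselCoeff ν) (z * x ^ 2 / 4) := by
  rw [besselJ, cpow_csqrt_mul_half hz hx]
  simp only [pow_mul, half_sq_csqrt]
  rfl

theorem sqrt_mul_rpow_half {x : ℝ} (hx : 0 < x) (μ : ℝ) :
    Real.sqrt (Real.pi * x / 2) * (x / 2) ^ μ =
      Real.sqrt Real.pi / 2 ^ (μ + 1 / 2) * x ^ (μ + 1 / 2) := by
  rw [mul_div_assoc, Real.sqrt_mul Real.pi_pos.le, Real.sqrt_eq_rpow (x / 2), mul_assoc,
    ← Real.rpow_add (by positivity), add_comm (1 / 2), Real.div_rpow hx.le zero_le_two]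
  ring

/-- The normalization constant `√(πx/2) (x/2)^μ = besselConst μ * x^{μ+1/2}`. -/
noncomputable def besselConst (μ : ℝ) : ℝ := Real.sqrt Real.pi / 2 ^ (μ + 1 / 2)

theorem ofReal_sqrt_mul_rpow_half {x : ℝ} (hx : 0 < x) (μ : ℝ) :
    (Real.sqrt (Real.pi * x / 2) : ℂ) * (((x / 2) ^ μ : ℝ) : ℂ) =
      (besselConst μ : ℂ) * ((x ^ (μ + 1 / 2) : ℝ) : ℂ) := by
  exact_mod_cast sqrt_mul_rpow_half hx μ

theorem EntireCoeff.powerSum_const_mul {a : ℕ → ℂ} (ha : EntireCoeff a) (c t : ℂ) :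
    powerSum (fun k => c * a k) t = c * powerSum a t :=
  ((ha.const_mul c).hasSum t).unique (((ha.hasSum t).mul_left c).congr_fun fun k => by ring)

theorem phiFree_eq_frobenius (l : ℝ) (z : ℂ) {x : ℝ} (hx : 0 < x) :
    phiFree l z x = frobenius (l + 1 / 2)
      (fun k => (besselConst (l + 1 / 2) : ℂ) * besselCoeff (l + 1 / 2) k) 0 z x := by
  rw [frobenius, powerSum_zero_coeff, mul_zero, add_zero,
    (entireCoeff_besselCoeff _).powerSum_const_mul]
  by_cases hz : z = 0
  · rw [phiFree, if_pos hz, hz, zero_mul, zero_div, powerSum_zero, besselCoeff, besselConst,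
      show (((l + 1 / 2 : ℝ) : ℂ) + ((0 : ℕ) : ℂ) + 1) = ((l + 3 / 2 : ℝ) : ℂ) by push_cast; ring,
      Complex.Gamma_ofReal, show l + 1 / 2 + 1 / 2 = l + 1 by ring]
    rw [pow_zero, Nat.factorial_zero, Nat.cast_one]
    push_cast
    ring
  · rw [phiFree, if_neg hz, besselJ_csqrt hz hx]
    have h1 : z ^ ((-((2 * l + 1) / 4) : ℝ) : ℂ) * z ^ (((l + 1 / 2) / 2 : ℝ) : ℂ) = 1 := by
      rw [← Complex.cpow_add _ _ hz, ← Complex.ofReal_add,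
        show -((2 * l + 1) / 4) + (l + 1 / 2) / 2 = 0 by ring, Complex.ofReal_zero,
        Complex.cpow_zero]
    linear_combination (Real.sqrt (Real.pi * x / 2) : ℂ) * (((x / 2) ^ (l + 1 / 2) : ℝ) : ℂ) *
      powerSum (besselCoeff (l + 1 / 2)) (z * x ^ 2 / 4) * h1 +
      powerSum (besselCoeff (l + 1 / 2)) (z * x ^ 2 / 4) * ofReal_sqrt_mul_rpow_half hx (l + 1 / 2)

/-! #### Noninteger order -/

theorem sin_mul_Gamma {ν : ℝ} (h : ∀ n : ℕ, (n : ℝ) ≠ ν) (hν : 0 ≤ ν) :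
    Real.sin (ν * Real.pi) ≠ 0 ∧
      Real.Gamma ν * Real.Gamma (1 - ν) * Real.sin (ν * Real.pi) = Real.pi := by
  have hs : Real.sin (ν * Real.pi) ≠ 0 := by
    rw [Ne, Real.sin_eq_zero_iff]
    rintro ⟨n, hn⟩
    have hn' : (n : ℝ) = ν := mul_right_cancel₀ Real.pi_ne_zero hn
    have : 0 ≤ n := by rw [← hn'] at hν; exact_mod_cast hν
    lift n to ℕ using this
    exact h n (by simpa using hn')
  refine ⟨hs, ?_⟩
  rw [Real.Gamma_mul_Gamma_one_sub, mul_comm Real.pi ν, div_mul_cancel₀ _ hs]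

theorem besselConst_mul (ν : ℝ) : besselConst ν * besselConst (-ν) = Real.pi / 2 := by
  have h1 : (2 : ℝ) ^ (ν + 1 / 2) * 2 ^ (-ν + 1 / 2) = 2 := by
    rw [← Real.rpow_add two_pos, show ν + 1 / 2 + (-ν + 1 / 2) = 1 by ring, Real.rpow_one]
  rw [besselConst, besselConst, div_mul_div_comm, Real.mul_self_sqrt Real.pi_pos.le, h1]

theorem besselCoeff_zero (ν : ℝ) : besselCoeff ν 0 = ((1 / Real.Gamma (ν + 1) : ℝ) : ℂ) := by
  rw [besselCoeff]
  push_cast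
  rw [← Complex.Gamma_ofReal]
  simp

/-- No logarithm occurs, and the Wronskian normalization is the reflection formula for `Γ` combined
with `besselConst_mul`. -/
theorem frobeniusPair_of_not_nat {ν : ℝ} (h : ∀ n : ℕ, (n : ℝ) ≠ ν) (hν : 0 ≤ ν) :
    FrobeniusPair ν (fun k => (besselConst ν : ℂ) * besselCoeff ν k)
      (fun k => ((besselConst (-ν) / Real.sin (ν * Real.pi) : ℝ) : ℂ) * besselCoeff (-ν) k) 0 where
  entire_a := (entireCoeff_besselCoeff ν).const_mul _
  entire_c := (entireCoeff_besselCoeff (-ν)).const_mul _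
  entire_b := entireCoeff_zero
  rec_a k := by linear_combination (besselConst ν : ℂ) * besselCoeff_succ ν k
  rec_b k := by simp
  rec_c k := by
    have := besselCoeff_succ (-ν) k
    push_cast at this
    simp only [Pi.zero_apply]
    linear_combination ((besselConst (-ν) / Real.sin (ν * Real.pi) : ℝ) : ℂ) * this
  mul_b_zero := by simp
  wronskian := by
    obtain ⟨hs, hG⟩ := sin_mul_Gamma h hν
    have hν0 : ν ≠ 0 := fun h0 => h 0 (by simp [h0])
    have hG1 : Real.Gamma ν ≠ 0 := fun h0 => Real.pi_ne_zero (by rw [← hG, h0]; ring)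
    have hG2 : Real.Gamma (1 - ν) ≠ 0 := fun h0 => Real.pi_ne_zero (by rw [← hG, h0]; ring)
    rw [besselCoeff_zero, besselCoeff_zero, Real.Gamma_add_one hν0,
      show -ν + 1 = 1 - ν by ring]
    have : besselConst ν * (1 / (ν * Real.Gamma ν)) * (2 * ν *
        (besselConst (-ν) / Real.sin (ν * Real.pi) * (1 / Real.Gamma (1 - ν)))) = 1 := by
      field_simp
      linear_combination 2 * besselConst_mul ν - hG
    rw [Pi.zero_apply, sub_zero]
    exact_mod_cast this

theorem thetaFree_eq_frobenius_of_not_nat {l : ℝ} (hl : -1 / 2 ≤ l)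
    (h : ∀ n : ℕ, (n : ℝ) ≠ l + 1 / 2) (z : ℂ) {x : ℝ} (hx : 0 < x) :
    thetaFree l z x = frobenius (-(l + 1 / 2))
      (fun k => ((besselConst (-(l + 1 / 2)) / Real.sin ((l + 1 / 2) * Real.pi) : ℝ) : ℂ) *
        besselCoeff (-(l + 1 / 2)) k) 0 z x := by
  obtain ⟨hs, hG⟩ := sin_mul_Gamma h (by linarith)
  rw [frobenius, powerSum_zero_coeff, mul_zero, add_zero,
    (entireCoeff_besselCoeff _).powerSum_const_mul]
  by_cases hz : z = 0
  · have hl' : l ≠ -1 / 2 := fun h0 => h 0 (by rw [h0]; norm_num)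
    have hν0 : l + 1 / 2 ≠ 0 := fun h0 => hl' (by linarith)
    have hG1 : Real.Gamma (l + 1 / 2) ≠ 0 := fun h0 => Real.pi_ne_zero (by rw [← hG, h0]; ring)
    have hG2 : Real.Gamma (1 - (l + 1 / 2)) ≠ 0 :=
      fun h0 => Real.pi_ne_zero (by rw [← hG, h0]; ring)
    rw [thetaFree, if_pos hz, if_neg hl', hz, zero_mul, zero_div, powerSum_zero, besselCoeff_zero,
      show l + 3 / 2 = l + 1 / 2 + 1 by ring, Real.Gamma_add_one hν0,
      show -(l + 1 / 2) + 1 = 1 - (l + 1 / 2) by ring,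
      show -(l + 1 / 2) + 1 / 2 = -l by ring, besselConst,
      show -(l + 1 / 2) + 1 / 2 = -l by ring, Real.rpow_neg hx.le, Real.rpow_neg zero_le_two,
      Real.rpow_add_one two_ne_zero]
    rw [← Complex.ofReal_mul, ← Complex.ofReal_mul, Complex.ofReal_inj]
    have hx2 : x ^ l ≠ 0 := (Real.rpow_pos_of_pos hx l).ne'
    have h2 : (2 : ℝ) ^ l ≠ 0 := (Real.rpow_pos_of_pos two_pos l).ne'
    have hp : Real.sqrt Real.pi ≠ 0 := (Real.sqrt_pos.2 Real.pi_pos).ne'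
    have hp2 : Real.sqrt Real.pi ^ 2 = Real.pi := Real.sq_sqrt Real.pi_pos.le
    rw [show 2 * l + 1 = 2 * (l + 1 / 2) by ring]
    generalize Real.Gamma (l + 1 / 2) = G1 at *
    generalize Real.Gamma (1 - (l + 1 / 2)) = G2 at *
    generalize Real.sin ((l + 1 / 2) * Real.pi) = S at *
    generalize l + 1 / 2 = n at *
    field_simp
    rw [hp2, ← hG]
    ring
  · have hfl : (⌊l + 1 / 2⌋₊ : ℝ) ≠ l + 1 / 2 := h _
    rw [thetaFree, if_neg hz, if_neg hfl, show -l - 1 / 2 = -(l + 1 / 2) by ring,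
      besselJ_csqrt hz hx]
    have h1 : z ^ (((2 * l + 1) / 4 : ℝ) : ℂ) * z ^ ((-(l + 1 / 2) / 2 : ℝ) : ℂ) = 1 := by
      rw [← Complex.cpow_add _ _ hz, ← Complex.ofReal_add,
        show (2 * l + 1) / 4 + -(l + 1 / 2) / 2 = 0 by ring, Complex.ofReal_zero,
        Complex.cpow_zero]
    have h2 := ofReal_sqrt_mul_rpow_half hx (-(l + 1 / 2))
    have e : ((besselConst (-(l + 1 / 2)) / Real.sin ((l + 1 / 2) * Real.pi) : ℝ) : ℂ) =
      -((-1 / Real.sin ((l + 1 / 2) * Real.pi) : ℝ) : ℂ) * (besselConst (-(l + 1 / 2)) : ℂ) := by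
      push_cast; ring
    rw [e]
    generalize powerSum _ _ = P
    generalize ((-1 / Real.sin ((l + 1 / 2) * Real.pi) : ℝ) : ℂ) = S
    linear_combination -S * P * h2 - (Real.sqrt (Real.pi * x / 2) : ℂ) *
      (((x / 2) ^ (-(l + 1 / 2)) : ℝ) : ℂ) * S * P * h1

/-! #### Integer order -/

/-- The coefficients of `∑_{k<n} p k t^k + t^n ∑ₖ q k t^k`. -/
def glueCoeff (n : ℕ) (p q : ℕ → ℂ) (k : ℕ) : ℂ := if k < n then p k else q (k - n)

theorem entireCoeff_glueCoeff (n : ℕ) (p : ℕ → ℂ) {q : ℕ → ℂ} (hq : EntireCoeff q) :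
    EntireCoeff (glueCoeff n p q) :=
  .of_nat_add n (by simpa [glueCoeff] using hq)

theorem powerSum_glueCoeff (n : ℕ) (p : ℕ → ℂ) {q : ℕ → ℂ} (hq : EntireCoeff q) (t : ℂ) :
    powerSum (glueCoeff n p q) t = ∑ k ∈ Finset.range n, p k * t ^ k + t ^ n * powerSum q t := by
  have h0 : HasSum (fun k => glueCoeff n p q (k + n) * t ^ (k + n)) (t ^ n * powerSum q t) :=
    ((hq.hasSum t).mul_left (t ^ n)).congr_fun fun k => by
      simp only [glueCoeff, not_lt.2 (Nat.le_add_left n k), if_false, Nat.add_sub_cancel, pow_add]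
      ring
  have h := (hasSum_nat_add_iff (f := fun k => glueCoeff n p q k * t ^ k) n).1 h0
  rw [((entireCoeff_glueCoeff n p hq).hasSum t).unique h, add_comm]
  congr 1
  exact Finset.sum_congr rfl fun k hk => by rw [glueCoeff, if_pos (Finset.mem_range.1 hk)]

/-- The coefficients of the last series in `Y_n`. -/
noncomputable def neumannTail (n k : ℕ) : ℂ :=
  ((digammaSucc k + digammaSucc (n + k) : ℝ) : ℂ) * (-1) ^ k /
    ((k.factorial : ℂ) * ((n + k).factorial : ℂ))

theorem besselCoeff_natCast (n k : ℕ) :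
    besselCoeff n k = (-1) ^ k / ((k.factorial : ℂ) * ((n + k).factorial : ℂ)) := by
  rw [besselCoeff, show (((n : ℝ) : ℂ) + k + 1) = ((n + k : ℕ) : ℂ) + 1 by push_cast; ring,
    Complex.Gamma_nat_eq_factorial]

theorem neumannTail_eq (n k : ℕ) :
    neumannTail n k = ((digammaSucc k + digammaSucc (n + k) : ℝ) : ℂ) * besselCoeff n k := by
  rw [neumannTail, besselCoeff_natCast, mul_div_assoc]

theorem digammaSucc_succ (m : ℕ) : digammaSucc (m + 1) = digammaSucc m + 1 / (m + 1) := by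
  rw [digammaSucc, digammaSucc, harmonic_succ]
  push_cast
  ring

theorem abs_digammaSucc_le (m : ℕ) : |digammaSucc m| ≤ m + 1 := by
  induction m with
  | zero =>
    have h1 := Real.one_half_lt_eulerMascheroniConstant
    have h2 := Real.eulerMascheroniConstant_lt_two_thirds
    simp only [digammaSucc, harmonic_zero, Rat.cast_zero, zero_sub, abs_neg, Nat.cast_zero,
      zero_add]
    rw [abs_of_pos] <;> linarith
  | succ m ih =>
    rw [digammaSucc_succ]
    have h : |1 / ((m : ℝ) + 1)| ≤ 1 := by
      rw [abs_of_nonneg (by positivity), div_le_one (by positivity)]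
      linarith [(Nat.cast_nonneg m : (0 : ℝ) ≤ m)]
    push_cast
    exact (abs_add_le _ _).trans (by linarith)

theorem entireCoeff_neumannTail (n : ℕ) : EntireCoeff (neumannTail n) := by
  have h := (entireCoeff_besselCoeff n).mul_of_le (C := n + 2)
    (b := fun k => ((digammaSucc k + digammaSucc (n + k) : ℝ) : ℂ)) fun k => by
      rw [Complex.norm_real, Real.norm_eq_abs]
      have h1 := abs_digammaSucc_le k
      have h2 := abs_digammaSucc_le (n + k)
      have h3 : (k : ℝ) + 1 ≤ 2 ^ k := by exact_mod_cast Nat.lt_two_pow_self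
      push_cast at h2
      refine (abs_add_le _ _).trans ?_
      nlinarith [(Nat.cast_nonneg n : (0 : ℝ) ≤ n), (Nat.cast_nonneg k : (0 : ℝ) ≤ k),
        mul_nonneg (Nat.cast_nonneg n : (0 : ℝ) ≤ n) (Nat.cast_nonneg k : (0 : ℝ) ≤ k)]
  simpa only [← neumannTail_eq] using h

/-- The digamma factors shift by `1/(k+1) + 1/(n+k+1)`, which the recurrence multiplies by
`(k+1)(k+1+n)`. The result `2k + n + 2` is the source produced by the logarithm. -/
theorem neumannTail_succ (n k : ℕ) :
    ((k : ℂ) + 1) * (k + 1 + n) * neumannTail n (k + 1) + neumannTail n k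
      - (2 * k + n + 2) * besselCoeff n (k + 1) = 0 := by
  have h := besselCoeff_succ n k
  rw [neumannTail_eq, neumannTail_eq, digammaSucc_succ, ← add_assoc n k 1, digammaSucc_succ]
  have hk1 : (k : ℂ) + 1 ≠ 0 := by exact_mod_cast k.succ_ne_zero
  have hk2 : (n : ℂ) + k + 1 ≠ 0 := by exact_mod_cast (n + k).succ_ne_zero
  have hk3 : (k : ℂ) + 1 + n ≠ 0 := by rwa [add_assoc, add_comm, add_right_comm, add_right_comm] at hk2
  push_cast at h ⊢
  have e : (1 : ℂ) / (k + 1) + 1 / (n + k + 1) = (2 * k + n + 2) / ((k + 1) * (k + 1 + n)) := by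
    rw [show (n : ℂ) + k + 1 = k + 1 + n by ring]
    field_simp
    ring
  have e2 : ((k : ℂ) + 1) * (k + 1 + n) * (1 / (k + 1) + 1 / (n + k + 1)) = 2 * k + n + 2 := by
    rw [e]; field_simp
  linear_combination ((digammaSucc k : ℂ) + digammaSucc (n + k)) * h +
    besselCoeff n (k + 1) * e2

/-- The coefficients of the polar part of `Y_n`. -/
noncomputable def neumannHead (n k : ℕ) : ℂ := ((n - k - 1).factorial : ℂ) / (k.factorial : ℂ)

/-- The recurrences split at the resonance `k + 1 = n`. Below it `b` vanishes and the polar part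
obeys the homogeneous recurrence. At it the factor `k + 1 - n` is zero, so `c n` is free and the
equation instead ties `b n` to `c (n - 1)`. Beyond it the Bessel and Neumann recurrences apply. The
Wronskian comes from `c 0` if `n > 0` and from `b 0` if `n = 0`. -/
theorem frobeniusPair_nat (n : ℕ) :
    FrobeniusPair n (fun k => (besselConst n : ℂ) * besselCoeff n k)
      (fun k => ((besselConst (-n) / Real.pi : ℝ) : ℂ) *
        glueCoeff n (neumannHead n) (neumannTail n) k)
      (fun k => ((besselConst (-n) / Real.pi : ℝ) : ℂ) * (-2 * glueCoeff n 0 (besselCoeff n) k)) where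
  entire_a := (entireCoeff_besselCoeff n).const_mul _
  entire_c := (entireCoeff_glueCoeff n _ (entireCoeff_neumannTail n)).const_mul _
  entire_b := ((entireCoeff_glueCoeff n _ (entireCoeff_besselCoeff n)).const_mul _).const_mul _
  rec_a k := by linear_combination (besselConst n : ℂ) * besselCoeff_succ n k
  rec_b k := by
    rcases lt_trichotomy (k + 1) n with h | h | h
    · simp [glueCoeff, h, Nat.lt_of_succ_lt h]
    · subst h
      simp [glueCoeff]
    · obtain ⟨j, rfl⟩ := Nat.exists_eq_add_of_le' (Nat.lt_succ_iff.1 h)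
      have := besselCoeff_succ n j
      simp only [glueCoeff, not_lt.2 (Nat.le_add_left n j), not_lt.2 h.le, if_false,
        Nat.add_sub_cancel, show j + n + 1 - n = j + 1 by omega]
      push_cast at this ⊢
      linear_combination ((besselConst (-n) / Real.pi : ℂ)) * (-2) * this
  rec_c k := by
    rcases lt_trichotomy (k + 1) n with h | h | h
    · obtain ⟨m, rfl⟩ := Nat.exists_eq_add_of_lt h
      simp only [glueCoeff, h, Nat.lt_of_succ_lt h, if_true, neumannHead,
        show k + 1 + m + 1 - k - 1 = m + 1 by omega,
        show k + 1 + m + 1 - (k + 1) - 1 = m by omega, Nat.factorial_succ, Pi.zero_apply]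
      have hk1 : (k : ℂ) + 1 ≠ 0 := by exact_mod_cast k.succ_ne_zero
      have hk : (k.factorial : ℂ) ≠ 0 := by exact_mod_cast k.factorial_ne_zero
      push_cast
      field_simp
      ring
    · subst h
      simp only [glueCoeff, lt_irrefl, Nat.lt_succ_self, if_true, if_false, neumannHead,
        Nat.sub_self, besselCoeff_natCast, show k + 1 - k - 1 = 0 by omega, Nat.factorial_succ,
        add_zero, Nat.factorial_zero, pow_zero]
      have hk1 : (k : ℂ) + 1 ≠ 0 := by exact_mod_cast k.succ_ne_zero
      have hk : (k.factorial : ℂ) ≠ 0 := by exact_mod_cast k.factorial_ne_zero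
      push_cast
      field_simp
      ring
    · obtain ⟨j, rfl⟩ := Nat.exists_eq_add_of_le' (Nat.lt_succ_iff.1 h)
      have := neumannTail_succ n j
      simp only [glueCoeff, not_lt.2 (Nat.le_add_left n j), not_lt.2 h.le, if_false,
        Nat.add_sub_cancel, show j + n + 1 - n = j + 1 by omega]
      push_cast at this ⊢
      linear_combination ((besselConst (-n) / Real.pi : ℂ)) * this
  mul_b_zero := by
    rcases Nat.eq_zero_or_pos n with h | h
    · simp [h]
    · simp [glueCoeff, h]
  wronskian := by
    have h1 : (besselConst n : ℂ) * besselConst (-n) = Real.pi / 2 := by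
      exact_mod_cast besselConst_mul n
    have hp : (Real.pi : ℂ) ≠ 0 := by exact_mod_cast Real.pi_ne_zero
    rcases Nat.eq_zero_or_pos n with h | h
    · subst h
      simp only [glueCoeff, lt_irrefl, if_false, besselCoeff_natCast]
      simp only [CharP.cast_eq_zero, neg_zero] at h1 ⊢
      simp
      field_simp
      linear_combination 2 * h1
    · obtain ⟨m, rfl⟩ : ∃ m, n = m + 1 := ⟨n - 1, by omega⟩
      simp only [glueCoeff, Nat.succ_pos m, if_true, besselCoeff_natCast, neumannHead, Nat.sub_zero,
        Nat.add_sub_cancel, Pi.zero_apply, pow_zero, Nat.factorial_zero, add_zero,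
        Nat.factorial_succ] at h1 ⊢
      have hk1 : (m : ℂ) + 1 ≠ 0 := by exact_mod_cast m.succ_ne_zero
      have hk : (m.factorial : ℂ) ≠ 0 := by exact_mod_cast m.factorial_ne_zero
      push_cast at h1 ⊢
      field_simp
      linear_combination 2 * (m + 1) * m.factorial * h1

/-- Subtracting `(1/π) log z` from `(2/π) log(√z x / 2)` leaves `(2/π) log(x/2)`: the branch cut in
`z` disappears and a Frobenius series remains. -/
theorem besselY_csqrt {z : ℂ} (hz : z ≠ 0) {x : ℝ} (hx : 0 < x) (n : ℕ) :
    -(csqrt z ^ n) * (besselY n (csqrt z * x) -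
        1 / (Real.pi : ℂ) * Complex.log z * besselJ n (csqrt z * x)) =
      (((x / 2) ^ (-(n : ℝ)) : ℝ) : ℂ) / Real.pi *
        (powerSum (glueCoeff n (neumannHead n) (neumannTail n)) (z * x ^ 2 / 4) +
          (Real.log (x / 2) : ℂ) *
            (-2 * powerSum (glueCoeff n 0 (besselCoeff n)) (z * x ^ 2 / 4))) := by
  set w := csqrt z * x / 2 with hw
  have ht : w ^ 2 = z * x ^ 2 / 4 := half_sq_csqrt z x
  have hp : (Real.pi : ℂ) ≠ 0 := by exact_mod_cast Real.pi_ne_zero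
  have hx2 : (x : ℂ) / 2 ≠ 0 := div_ne_zero (by exact_mod_cast hx.ne') two_ne_zero
  have hk := csqrt_ne_zero hz
  have hwe : w = csqrt z * (x / 2) := by rw [hw]; ring
  have hJ : besselJ n (csqrt z * x) = w ^ n * powerSum (besselCoeff n) (w ^ 2) := by
    rw [besselJ]
    simp only [pow_mul, ← hw, Complex.ofReal_natCast, Complex.cpow_natCast]
    rfl
  have hH : ∑ k ∈ Finset.range n, ((n - k - 1).factorial : ℂ) / (k.factorial : ℂ) * w ^ (2 * k) =
      ∑ k ∈ Finset.range n, neumannHead n k * (w ^ 2) ^ k :=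
    Finset.sum_congr rfl fun k _ => by rw [neumannHead, pow_mul]
  have hT : ∑' k : ℕ, ((digammaSucc k + digammaSucc (n + k) : ℝ) : ℂ) * (-1) ^ k /
        ((k.factorial : ℂ) * ((n + k).factorial : ℂ)) * w ^ (2 * k) =
      powerSum (neumannTail n) (w ^ 2) := by
    simp only [pow_mul]; rfl
  rw [besselY, ← hw, hH, hT, hJ, ← ht, powerSum_glueCoeff _ _ (entireCoeff_neumannTail n),
    powerSum_glueCoeff _ _ (entireCoeff_besselCoeff n), log_csqrt_mul_half hz hx,
    Real.rpow_neg (by positivity), Real.rpow_natCast]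
  push_cast
  simp only [Pi.zero_apply, zero_mul, Finset.sum_const_zero, zero_add]
  generalize ∑ k ∈ Finset.range n, neumannHead n k * (w ^ 2) ^ k = H
  generalize powerSum (neumannTail n) (w ^ 2) = T
  generalize powerSum (besselCoeff n) (w ^ 2) = F
  rw [← pow_mul, mul_comm 2 n, pow_mul, hwe]
  simp only [mul_pow]
  have h1 : csqrt z ^ n ≠ 0 := pow_ne_zero _ hk
  have h2 : ((x : ℂ) / 2) ^ n ≠ 0 := pow_ne_zero _ hx2
  generalize csqrt z ^ n = K at *
  generalize ((x : ℂ) / 2) ^ n = X at *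
  field_simp
  ring

theorem thetaFree_eq_frobenius_nat {l : ℝ} {n : ℕ} (h : l + 1 / 2 = n) (z : ℂ) {x : ℝ}
    (hx : 0 < x) :
    thetaFree l z x = frobenius (-n)
      (fun k => ((besselConst (-n) / Real.pi : ℝ) : ℂ) *
        glueCoeff n (neumannHead n) (neumannTail n) k)
      (fun k => ((besselConst (-n) / Real.pi : ℝ) : ℂ) * (-2 * glueCoeff n 0 (besselCoeff n) k))
      z x := by
  have hl : l = n - 1 / 2 := by linarith
  have hg := entireCoeff_glueCoeff n 0 (entireCoeff_besselCoeff n)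
  rw [frobenius, (entireCoeff_glueCoeff n _ (entireCoeff_neumannTail n)).powerSum_const_mul,
    (hg.const_mul (-2)).powerSum_const_mul, hg.powerSum_const_mul]
  by_cases hz : z = 0
  · rw [thetaFree, if_pos hz, hz, zero_mul, zero_div, powerSum_zero, powerSum_zero]
    have hp : Real.sqrt Real.pi ≠ 0 := (Real.sqrt_pos.2 Real.pi_pos).ne'
    have hp2 : Real.sqrt Real.pi ^ 2 = Real.pi := Real.sq_sqrt Real.pi_pos.le
    -- Only `n = 0` keeps a logarithm at `z = 0`; for `n > 0` the logarithmic series starts at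
    -- `t^n`.
    rcases Nat.eq_zero_or_pos n with h0 | h0
    · subst h0
      rw [if_pos (by rw [hl]; norm_num)]
      have hb : besselCoeff 0 0 = 1 := by simpa using besselCoeff_natCast 0 0
      simp only [glueCoeff, lt_irrefl, if_false, hb, neumannTail, digammaSucc,
        besselConst, Nat.cast_zero, neg_zero, zero_add, harmonic_zero, Nat.factorial_zero,
        Nat.sub_self, pow_zero, Nat.cast_one, mul_one, div_one, Rat.cast_zero, zero_sub,
        add_zero, ← Real.sqrt_eq_rpow]
      rw [mul_div_assoc, Real.sqrt_mul zero_le_two, Real.sqrt_div hx.le,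
        Real.log_div hx.ne' two_ne_zero]
      have h2 : Real.sqrt 2 ≠ 0 := (Real.sqrt_pos.2 two_pos).ne'
      have h22 : Real.sqrt 2 ^ 2 = 2 := Real.sq_sqrt zero_le_two
      have : Real.sqrt 2 * (Real.sqrt x / Real.sqrt Real.pi) *
          (Real.log 2 - Real.eulerMascheroniConstant - Real.log x) =
          Real.sqrt x * (Real.sqrt Real.pi / Real.sqrt 2 / Real.pi *
            (-Real.eulerMascheroniConstant + -Real.eulerMascheroniConstant) +
            (Real.log x - Real.log 2) * (Real.sqrt Real.pi / Real.sqrt 2 / Real.pi * -2)) := by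
        generalize Real.sqrt Real.pi = s at *
        rw [← hp2]
        field_simp
        rw [h22]
        ring
      rw [this]
      push_cast
      ring
    · obtain ⟨m, rfl⟩ : ∃ m, n = m + 1 := ⟨n - 1, by omega⟩
      have hl2 : l ≠ -1 / 2 := by
        rw [hl]; push_cast; intro h3
        linarith [(Nat.cast_nonneg m : (0 : ℝ) ≤ m)]
      rw [if_neg hl2]
      simp only [glueCoeff, Nat.succ_pos m, if_true, neumannHead, Nat.sub_zero,
        Nat.add_sub_cancel, Pi.zero_apply, Nat.factorial_zero, mul_zero, add_zero,
        Nat.cast_one, div_one]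
      rw [show l + 3 / 2 = ((m + 1 : ℕ) : ℝ) + 1 by rw [← h]; ring, Real.Gamma_nat_eq_factorial,
        show 2 * l + 1 = 2 * ((m + 1 : ℕ) : ℝ) by rw [← h]; ring, besselConst,
        show -((m + 1 : ℕ) : ℝ) + 1 / 2 = -l by rw [← h]; ring, Real.rpow_neg hx.le,
        Real.rpow_neg zero_le_two, Real.rpow_add_one two_ne_zero, Nat.factorial_succ]
      have hx2 : x ^ l ≠ 0 := (Real.rpow_pos_of_pos hx l).ne'
      have h2 : (2 : ℝ) ^ l ≠ 0 := (Real.rpow_pos_of_pos two_pos l).ne'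
      have hm : ((m : ℝ) + 1) ≠ 0 := by positivity
      have : ((m + 1 : ℕ) * m.factorial : ℕ) * (2 ^ l * 2) / (x ^ l * Real.sqrt Real.pi) *
          (1 / (2 * ((m + 1 : ℕ) : ℝ))) = (x ^ l)⁻¹ *
          (Real.sqrt Real.pi / (2 ^ l)⁻¹ / Real.pi * m.factorial) := by
        generalize Real.sqrt Real.pi = s at *
        rw [← hp2]
        push_cast
        field_simp
      rw [this]
      push_cast
      ring
  · have hfl : ⌊l + 1 / 2⌋₊ = n := by rw [h]; exact Nat.floor_natCast n
    rw [thetaFree, if_neg hz, hfl, if_pos h.symm, h]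
    have hc : z ^ (((2 * l + 1) / 4 : ℝ) : ℂ) = csqrt z ^ n := by
      rw [csqrt, ← Complex.cpow_nat_mul]
      congr 1
      rw [hl]; push_cast; ring
    have h1 := besselY_csqrt hz hx n
    have h2 := ofReal_sqrt_mul_rpow_half hx (-(n : ℝ))
    rw [hc]
    push_cast at h1 h2 ⊢
    linear_combination (Real.sqrt (Real.pi * x / 2) : ℂ) * h1 +
      1 / (Real.pi : ℂ) * (powerSum (glueCoeff n (neumannHead n) (neumannTail n)) (z * x ^ 2 / 4) +
          (Real.log (x / 2) : ℂ) *
            (-2 * powerSum (glueCoeff n 0 (besselCoeff n)) (z * x ^ 2 / 4))) * h2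

/-! ### The free solutions -/

/-- These properties are all that the later estimates use about Bessel functions. -/
theorem exists_free_solutions {l : ℝ} (hl : -1 / 2 ≤ l) (z : ℂ) :
    ∃ p r : ℝ → ℂ, IsFreeSolution l z (phiFree l z) p ∧ IsFreeSolution l z (thetaFree l z) r ∧
      ∀ x, 0 < x → thetaFree l z x * p x - r x * phiFree l z x = 1 := by
  obtain ⟨c, b, hp, he⟩ : ∃ c b : ℕ → ℂ, FrobeniusPair (l + 1 / 2)
      (fun k => (besselConst (l + 1 / 2) : ℂ) * besselCoeff (l + 1 / 2) k) c b ∧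
      ∀ x, 0 < x → thetaFree l z x = frobenius (-(l + 1 / 2)) c b z x := by
    by_cases h : ∃ n : ℕ, (n : ℝ) = l + 1 / 2
    · obtain ⟨n, hn⟩ := h
      have := fun x (hx : 0 < x) => thetaFree_eq_frobenius_nat hn.symm z hx
      rw [← hn]
      exact ⟨_, _, frobeniusPair_nat n, this⟩
    · push Not at h
      exact ⟨_, _, frobeniusPair_of_not_nat h (by linarith),
        fun x hx => thetaFree_eq_frobenius_of_not_nat hl h z hx⟩
  have hφ := fun x (hx : 0 < x) => phiFree_eq_frobenius l z hx
  have h1 := hp.isFreeSolution_left rfl z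
  have h2 := hp.isFreeSolution_right rfl z
  refine ⟨_, _, ⟨fun x hx => (h1.hasDerivAt x hx).congr_of_eventuallyEq ?_, fun x hx => ?_⟩,
    ⟨fun x hx => (h2.hasDerivAt x hx).congr_of_eventuallyEq ?_, fun x hx => ?_⟩, fun x hx => ?_⟩
  · filter_upwards [Ioi_mem_nhds hx] with y hy using hφ y hy
  · rw [hφ x hx]; exact h1.hasDerivAt_deriv x hx
  · filter_upwards [Ioi_mem_nhds hx] with y hy using he y hy
  · rw [he x hx]; exact h2.hasDerivAt_deriv x hx
  · rw [hφ x hx, he x hx]; exact hp.wronskian_eq_one z hx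

/-! ### Bounds for the free equation -/

/-- `E exp(-P)` is antitone; no sign of `E` or `p` is required. -/
theorem le_mul_exp_of_deriv_le {E E' P p : ℝ → ℝ} {a b : ℝ} (hab : a ≤ b)
    (hE : ∀ y ∈ Icc a b, HasDerivAt E (E' y) y) (hP : ∀ y ∈ Icc a b, HasDerivAt P (p y) y)
    (h : ∀ y ∈ Icc a b, E' y ≤ p y * E y) : E b ≤ E a * Real.exp (P b - P a) := by
  have hd : ∀ y ∈ Icc a b, HasDerivAt (fun y => E y * Real.exp (-P y))
      ((E' y - p y * E y) * Real.exp (-P y)) y := fun y hy =>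
    ((hE y hy).mul (hP y hy).neg.exp).congr_deriv (by simp only [Pi.neg_apply]; ring)
  have hanti : AntitoneOn (fun y => E y * Real.exp (-P y)) (Icc a b) := by
    refine antitoneOn_of_deriv_nonpos (convex_Icc a b)
      (fun y hy => (hd y hy).continuousAt.continuousWithinAt)
      (fun y hy => (hd y (interior_subset hy)).differentiableAt.differentiableWithinAt)
      fun y hy => ?_
    rw [(hd y (interior_subset hy)).deriv]
    exact mul_nonpos_of_nonpos_of_nonneg (sub_nonpos.2 (h y (interior_subset hy)))
      (Real.exp_nonneg _)
  have := hanti (left_mem_Icc.2 hab) (right_mem_Icc.2 hab) hab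
  simp only [Real.exp_neg, ← div_eq_mul_inv] at this
  rw [div_le_iff₀ (Real.exp_pos _)] at this
  rw [Real.exp_sub]
  calc _ ≤ _ := this
    _ = _ := by ring

theorem norm_csqrt (z : ℂ) : ‖csqrt z‖ = Real.sqrt ‖z‖ := by
  conv_rhs => rw [← csqrt_sq z, norm_pow, Real.sqrt_sq (norm_nonneg _)]

/-- With `k = √z`, `|z| - z̄ = k̄ (k - k̄)`. This is why the energy grows at a rate governed by `|Im
√z|` and not by `|√z|`. -/
theorem norm_normSq_sub_conj (z : ℂ) :
    ‖((‖z‖ : ℝ) : ℂ) - (starRingEnd ℂ) z‖ = 2 * Real.sqrt ‖z‖ * |(csqrt z).im| := by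
  have h1 : ((‖z‖ : ℝ) : ℂ) = (starRingEnd ℂ) (csqrt z) * csqrt z := by
    rw [Complex.conj_mul', ← Complex.ofReal_pow, norm_csqrt, Real.sq_sqrt (norm_nonneg _)]
  have h2 : (starRingEnd ℂ) z = (starRingEnd ℂ) (csqrt z) * (starRingEnd ℂ) (csqrt z) := by
    conv_lhs => rw [← csqrt_sq z, map_pow, sq]
  rw [h1, h2, ← mul_sub, norm_mul, RCLike.norm_conj, norm_csqrt, Complex.sub_conj, norm_mul]
  simp
  ring

/-- The energy `‖f'‖² + |z| ‖f‖²` of a free solution grows at most like `exp (2 |Im √z| x)` in the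
region `|z|^{1/2} x ≥ 1`. -/
theorem IsFreeSolution.energy_le {l : ℝ} {z : ℂ} {g g' : ℝ → ℂ} (h : IsFreeSolution l z g g')
    (hz : z ≠ 0) {a y : ℝ} (ha : 0 < a) (hsa : 1 ≤ Real.sqrt ‖z‖ * a) (hay : a ≤ y) :
    ‖g' y‖ ^ 2 + ‖z‖ * ‖g y‖ ^ 2 ≤ (‖g' a‖ ^ 2 + ‖z‖ * ‖g a‖ ^ 2) *
      Real.exp (2 * (|(csqrt z).im| * (y - a)) + |l * (l + 1)|) := by
  set s := Real.sqrt ‖z‖ with hs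
  set κ := |(csqrt z).im| with hκ
  set c := l * (l + 1) with hc
  have hs0 : 0 < s := Real.sqrt_pos.2 (norm_pos_iff.2 hz)
  have hs2 : s ^ 2 = ‖z‖ := Real.sq_sqrt (norm_nonneg _)
  -- The rate `2κ` comes from the `z`-terms. The rate `|c| / (s y²)` comes from `c / x²` together
  -- with `2 s |g| |g'| ≤ E`; its integral from `a` on is at most `|c| / (s a) ≤ |c|`.
  have key := le_mul_exp_of_deriv_le (E := fun y => ‖g' y‖ ^ 2 + ‖z‖ * ‖g y‖ ^ 2)
    (P := fun y => 2 * κ * y - |c| / s * y⁻¹) (p := fun y => 2 * κ + |c| / s / y ^ 2) hay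
    (fun t ht => ((h.hasDerivAt_deriv t (ha.trans_le ht.1)).norm_sq).add
      ((h.hasDerivAt t (ha.trans_le ht.1)).norm_sq.const_mul ‖z‖))
    (fun t ht => ?_) (fun t ht => ?_)
  · refine key.trans ?_
    gcongr
    have h1 : |c| / s * a⁻¹ ≤ |c| := by
      rw [div_mul_eq_mul_div, ← div_eq_mul_inv, div_div, div_le_iff₀ (by positivity)]
      have := mul_le_mul_of_nonneg_left hsa (abs_nonneg c)
      linarith [mul_comm a s]
    have h2 : 0 ≤ |c| / s * y⁻¹ := by
      have := ha.trans_le hay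
      positivity
    linarith
  · have ht0 : t ≠ 0 := (ha.trans_le ht.1).ne'
    refine (((hasDerivAt_id' t).const_mul (2 * κ)).sub
      ((hasDerivAt_inv ht0).const_mul (|c| / s))).congr_deriv ?_
    field_simp
    ring
  · have ht0 : 0 < t := ha.trans_le ht.1
    have i1 : inner ℝ (g' t) (((l * (l + 1) / t ^ 2 : ℝ) - z) * g t) =
        ((starRingEnd ℂ) (g' t) * (((c / t ^ 2 : ℝ) - z) * g t)).re := by
      rw [Complex.inner, mul_comm]
    have i2 : inner ℝ (g t) (g' t) = ((starRingEnd ℂ) (g t) * g' t).re := by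
      rw [Complex.inner, mul_comm]
    rw [i1, i2]
    set G := ‖g t‖
    set G' := ‖g' t‖
    -- Conjugating the term with `z` inside the real part merges it with the one carrying `|z|`,
    -- leaving the coefficient `|z| - z̄`.
    have e : ((starRingEnd ℂ) (g' t) * (((c / t ^ 2 : ℝ) - z) * g t)).re +
        ‖z‖ * ((starRingEnd ℂ) (g t) * g' t).re =
        c / t ^ 2 * ((starRingEnd ℂ) (g t) * g' t).re +
          ((((‖z‖ : ℝ) : ℂ) - (starRingEnd ℂ) z) * ((starRingEnd ℂ) (g t) * g' t)).re := by
      simp only [Complex.mul_re, Complex.mul_im, Complex.sub_re, Complex.sub_im, Complex.conj_re,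
        Complex.conj_im, Complex.ofReal_re, Complex.ofReal_im]
      ring
    have hw : ‖(starRingEnd ℂ) (g t) * g' t‖ = G * G' := by rw [norm_mul, RCLike.norm_conj]
    have b1 : c / t ^ 2 * ((starRingEnd ℂ) (g t) * g' t).re ≤ |c| / t ^ 2 * (G * G') := by
      refine (le_abs_self _).trans ?_
      rw [abs_mul, abs_div, abs_of_pos (pow_pos ht0 2), ← hw]
      gcongr
      exact Complex.abs_re_le_norm _
    have b2 : ((((‖z‖ : ℝ) : ℂ) - (starRingEnd ℂ) z) * ((starRingEnd ℂ) (g t) * g' t)).re ≤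
        2 * s * κ * (G * G') := by
      refine (Complex.re_le_norm _).trans ?_
      rw [norm_mul, hw, norm_normSq_sub_conj]
    have hGG : 2 * s * (G * G') ≤ G' ^ 2 + ‖z‖ * G ^ 2 := by
      rw [← hs2]; nlinarith [sq_nonneg (G' - s * G)]
    have b3 : |c| / t ^ 2 * (G * G') * 2 ≤ |c| / s / t ^ 2 * (G' ^ 2 + ‖z‖ * G ^ 2) := by
      calc _ = |c| / s / t ^ 2 * (2 * s * (G * G')) := by field_simp
        _ ≤ _ := by gcongr
    have b4 : κ * (2 * s * (G * G')) ≤ κ * (G' ^ 2 + ‖z‖ * G ^ 2) := by gcongr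
    calc _ = 2 * (((starRingEnd ℂ) (g' t) * (((c / t ^ 2 : ℝ) - z) * g t)).re +
        ‖z‖ * ((starRingEnd ℂ) (g t) * g' t).re) := by ring
      _ ≤ _ := by rw [e]; linarith

theorem IsFreeSolution.bound_of_one_le {l : ℝ} {z : ℂ} {g g' : ℝ → ℂ}
    (h : IsFreeSolution l z g g') (hz : z ≠ 0) {a y B : ℝ} (ha : 0 < a)
    (hsa : 1 ≤ Real.sqrt ‖z‖ * a) (hay : a ≤ y) (hB : 0 ≤ B) (h1 : ‖g a‖ ≤ B)
    (h2 : ‖g' a‖ ≤ Real.sqrt ‖z‖ * B) :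
    ‖g y‖ ≤ 2 * Real.exp |l * (l + 1)| * B * Real.exp (|(csqrt z).im| * (y - a)) ∧
    ‖g' y‖ ≤ Real.sqrt ‖z‖ * (2 * Real.exp |l * (l + 1)| * B *
      Real.exp (|(csqrt z).im| * (y - a))) := by
  have key := h.energy_le hz ha hsa hay
  set s := Real.sqrt ‖z‖ with hs
  have hs0 : 0 < s := Real.sqrt_pos.2 (norm_pos_iff.2 hz)
  have hs2 : ‖z‖ = s ^ 2 := (Real.sq_sqrt (norm_nonneg _)).symm
  set e := Real.exp (|(csqrt z).im| * (y - a))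
  set D := 2 * Real.exp |l * (l + 1)| * B * e with hD
  have hD0 : 0 ≤ D := by positivity
  have hc : Real.exp |l * (l + 1)| ≤ Real.exp |l * (l + 1)| ^ 2 :=
    le_self_pow₀ (Real.one_le_exp (abs_nonneg _)) two_ne_zero
  have hE : ‖g' y‖ ^ 2 + s ^ 2 * ‖g y‖ ^ 2 ≤ (s * D) ^ 2 := by
    rw [← hs2]
    refine key.trans ?_
    have h3 : ‖g' a‖ ^ 2 + ‖z‖ * ‖g a‖ ^ 2 ≤ (s * B) ^ 2 + s ^ 2 * B ^ 2 := by
      rw [hs2]; gcongr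
    rw [Real.exp_add, two_mul, Real.exp_add]
    calc _ ≤ ((s * B) ^ 2 + s ^ 2 * B ^ 2) * (e * e * Real.exp |l * (l + 1)| ^ 2) := by gcongr
      _ ≤ _ := by
        rw [hD]
        nlinarith [sq_nonneg (s * B * e * Real.exp |l * (l + 1)|)]
  constructor
  · refine (pow_le_pow_iff_left₀ (norm_nonneg _) hD0 two_ne_zero).1 ?_
    have : s ^ 2 * ‖g y‖ ^ 2 ≤ s ^ 2 * D ^ 2 := by
      rw [← mul_pow s D]; nlinarith [sq_nonneg ‖g' y‖]
    exact le_of_mul_le_mul_left this (by positivity)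
  · refine (pow_le_pow_iff_left₀ (norm_nonneg _) (by positivity) two_ne_zero).1 ?_
    nlinarith [sq_nonneg (s * ‖g y‖)]

/-- In the region `|z|^{1/2} y ≤ 1` a free solution is controlled by the case `z = 0`. -/
theorem IsFreeSolution.bound_of_le_one {l : ℝ} (hl : -1 / 2 < l) {z : ℂ} {g g' : ℝ → ℂ}
    (h : IsFreeSolution l z g g') {x y : ℝ} (hx : 0 < x) (hxy : x ≤ y)
    (hsy : Real.sqrt ‖z‖ * y ≤ 1) (h0 : g x = 0) (h1 : g' x = -1) :
    ‖g y‖ ≤ 2 * (|l| + |l + 1| + 1) / (2 * l + 1) * Real.exp (2 / (2 * l + 1)) *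
      (x ^ (-l) * y ^ (l + 1)) ∧
    y * ‖g' y‖ ≤ 2 * (|l| + |l + 1| + 1) / (2 * l + 1) * Real.exp (2 / (2 * l + 1)) *
      (x ^ (-l) * y ^ (l + 1)) := by
  set μ := 2 * l + 1 with hμ
  have hμ0 : 0 < μ := by linarith
  have hy : 0 < y := hx.trans_le hxy
  -- `p` and `r` diagonalize the equation at `z = 0`: there `t p' = (l + 1) p` and `t r' = -l r`.
  -- Since `g = (p - r) / (2 l + 1)`, the case `l = -1/2` needs another argument.
  set p : ℝ → ℂ := fun t => t * g' t + l * g t with hp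
  set r : ℝ → ℂ := fun t => t * g' t - (l + 1) * g t with hr
  have hdp : ∀ t, 0 < t → HasDerivAt p ((l + 1) / t * p t - z * t * g t) t := fun t ht => by
    have ht' : (t : ℂ) ≠ 0 := by exact_mod_cast ht.ne'
    refine (((hasDerivAt_id' t).ofReal_comp.mul (h.hasDerivAt_deriv t ht)).add
      ((h.hasDerivAt t ht).const_mul (l : ℂ))).congr_deriv ?_
    simp only [hp]
    push_cast
    field_simp
    ring
  have hdr : ∀ t, 0 < t → HasDerivAt r (-l / t * r t - z * t * g t) t := fun t ht => by
    have ht' : (t : ℂ) ≠ 0 := by exact_mod_cast ht.ne'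
    refine (((hasDerivAt_id' t).ofReal_comp.mul (h.hasDerivAt_deriv t ht)).sub
      ((h.hasDerivAt t ht).const_mul ((l : ℂ) + 1))).congr_deriv ?_
    simp only [hr]
    push_cast
    field_simp
    ring
  have hg : ∀ t, ‖g t‖ = ‖p t - r t‖ / μ := fun t => by
    have : p t - r t = (μ : ℂ) * g t := by simp only [hp, hr, hμ]; push_cast; ring
    rw [this, norm_mul, Complex.norm_real, Real.norm_of_nonneg hμ0.le]
    field_simp
  -- The larger exponent `l + 1` dominates both components. The data at `x` contribute `2 x²`, so
  -- the leading growth is `x (y/x)^{l+1} = x^{-l} y^{l+1}`; the term with `|z|` adds a bounded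
  -- exponent because `|z| y² ≤ 1`.
  have key := le_mul_exp_of_deriv_le (E := fun t => ‖p t‖ ^ 2 + ‖r t‖ ^ 2)
    (P := fun t => 2 * (l + 1) * Real.log t + 2 * ‖z‖ / μ * t ^ 2)
    (p := fun t => 2 * (l + 1) / t + 4 * ‖z‖ * t / μ) hxy
    (fun t ht => (hdp t (hx.trans_le ht.1)).norm_sq.add (hdr t (hx.trans_le ht.1)).norm_sq)
    (fun t ht => ?_) (fun t ht => ?_)
  · have hsy2 : ‖z‖ * y ^ 2 ≤ 1 := by
      rw [← Real.sq_sqrt (norm_nonneg z), ← mul_pow]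
      exact pow_le_one₀ (by positivity) hsy
    have hX0 : 0 < x ^ (-l) * y ^ (l + 1) := by positivity
    set X := x ^ (-l) * y ^ (l + 1) with hX
    have hXe : x * Real.exp ((l + 1) * Real.log y - (l + 1) * Real.log x) = X := by
      rw [Real.exp_sub, mul_comm _ (Real.log y), mul_comm _ (Real.log x), ← Real.rpow_def_of_pos hy,
        ← Real.rpow_def_of_pos hx, hX, Real.rpow_add_one hx.ne', Real.rpow_neg hx.le]
      field_simp
    have hE : ‖p y‖ ^ 2 + ‖r y‖ ^ 2 ≤ 2 * (X * Real.exp (2 / μ)) ^ 2 := by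
      refine key.trans ?_
      have e1 : ‖p x‖ ^ 2 + ‖r x‖ ^ 2 = 2 * x ^ 2 := by
        simp only [hp, hr, h0, h1]
        simp
        ring
      simp only [e1]
      rw [← hXe]
      have e2 : 2 * (l + 1) * Real.log y + 2 * ‖z‖ / μ * y ^ 2 -
          (2 * (l + 1) * Real.log x + 2 * ‖z‖ / μ * x ^ 2) ≤
          2 * ((l + 1) * Real.log y - (l + 1) * Real.log x) + 2 * (2 / μ) := by
        have b1 : 2 * ‖z‖ / μ * y ^ 2 ≤ 2 / μ := by
          rw [div_mul_eq_mul_div]; gcongr; nlinarith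
        have b2 : 0 ≤ 2 * ‖z‖ / μ * x ^ 2 := by positivity
        have b3 : 0 < 2 / μ := by positivity
        linarith
      calc _ ≤ 2 * x ^ 2 * Real.exp (2 * ((l + 1) * Real.log y - (l + 1) * Real.log x) +
            2 * (2 / μ)) := by gcongr
        _ = _ := by
            have hsq : ∀ A, Real.exp (2 * A) = Real.exp A ^ 2 := fun A => by
              rw [two_mul, Real.exp_add, sq]
            rw [Real.exp_add, hsq, hsq]; ring
    set D := X * Real.exp (2 / μ) with hD
    have hD0 : 0 < D := by positivity
    have hpD : ‖p y‖ ≤ 2 * D :=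
      (pow_le_pow_iff_left₀ (norm_nonneg _) (by positivity) two_ne_zero).1
        (by nlinarith [sq_nonneg ‖r y‖, sq_nonneg D])
    have hrD : ‖r y‖ ≤ 2 * D :=
      (pow_le_pow_iff_left₀ (norm_nonneg _) (by positivity) two_ne_zero).1
        (by nlinarith [sq_nonneg ‖p y‖, sq_nonneg D])
    have hll : 1 ≤ |l| + |l + 1| := by
      have := abs_sub (l + 1) l
      rw [add_sub_cancel_left, abs_one] at this
      linarith
    constructor
    · rw [hg]
      calc _ ≤ (2 * D + 2 * D) / μ := by
            gcongr; exact (norm_sub_le _ _).trans (add_le_add hpD hrD)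
        _ ≤ 2 * (|l| + |l + 1| + 1) * D / μ := by gcongr; nlinarith
        _ = _ := by rw [hD]; ring
    · have e3 : (y : ℂ) * g' y = ((l + 1) * p y + l * r y) / μ := by
        have : (μ : ℂ) ≠ 0 := by exact_mod_cast hμ0.ne'
        rw [eq_div_iff this]
        simp only [hp, hr, hμ]
        push_cast
        ring
      have e4 : y * ‖g' y‖ = ‖(y : ℂ) * g' y‖ := by
        rw [norm_mul, Complex.norm_real, Real.norm_of_nonneg hy.le]
      have e5 : ‖(l : ℂ) + 1‖ = |l + 1| := by
        rw [← Real.norm_eq_abs, ← Complex.norm_real]; push_cast; rfl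
      rw [e4, e3, norm_div, Complex.norm_real, Real.norm_of_nonneg hμ0.le]
      calc _ ≤ (|l + 1| * (2 * D) + |l| * (2 * D)) / μ := by
            gcongr
            refine (norm_add_le _ _).trans ?_
            rw [norm_mul, norm_mul, e5, Complex.norm_real, Real.norm_eq_abs]
            gcongr
        _ ≤ 2 * (|l| + |l + 1| + 1) * D / μ := by gcongr; nlinarith
        _ = _ := by rw [hD]; ring
  · have ht0 : t ≠ 0 := (hx.trans_le ht.1).ne'
    refine (((Real.hasDerivAt_log ht0).const_mul (2 * (l + 1))).add
      (((hasDerivAt_id' t).pow 2).const_mul (2 * ‖z‖ / μ))).congr_deriv ?_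
    push_cast
    field_simp
    ring
  · have ht0 : 0 < t := hx.trans_le ht.1
    have b1 : inner ℝ (p t) ((l + 1) / t * p t - z * t * g t) ≤
        (l + 1) / t * ‖p t‖ ^ 2 + ‖p t‖ * (‖z‖ * t * ‖g t‖) := by
      have e : (((l : ℂ) + 1) / t * p t) = ((l + 1) / t : ℝ) • p t := by
        rw [Complex.real_smul]; push_cast; rfl
      rw [inner_sub_right, e, real_inner_smul_right, real_inner_self_eq_norm_sq]
      have := (abs_le.1 (abs_real_inner_le_norm (p t) (z * t * g t))).1
      rw [norm_mul, norm_mul, Complex.norm_real, Real.norm_of_nonneg ht0.le] at this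
      linarith
    have b2 : inner ℝ (r t) (-l / t * r t - z * t * g t) ≤
        (l + 1) / t * ‖r t‖ ^ 2 + ‖r t‖ * (‖z‖ * t * ‖g t‖) := by
      have e : (-(l : ℂ) / t * r t) = (-l / t : ℝ) • r t := by
        rw [Complex.real_smul]; push_cast; rfl
      rw [inner_sub_right, e, real_inner_smul_right, real_inner_self_eq_norm_sq]
      have := (abs_le.1 (abs_real_inner_le_norm (r t) (z * t * g t))).1
      rw [norm_mul, norm_mul, Complex.norm_real, Real.norm_of_nonneg ht0.le] at this
      have : -l / t * ‖r t‖ ^ 2 ≤ (l + 1) / t * ‖r t‖ ^ 2 := by gcongr; linarith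
      linarith
    have b3 : ‖g t‖ ≤ (‖p t‖ + ‖r t‖) / μ := by
      rw [hg]; gcongr; exact norm_sub_le _ _
    have b4 : (‖p t‖ + ‖r t‖) * (‖z‖ * t * ‖g t‖) ≤ 2 * (‖z‖ * t / μ) * (‖p t‖ ^ 2 + ‖r t‖ ^ 2) := by
      calc _ ≤ (‖p t‖ + ‖r t‖) * (‖z‖ * t * ((‖p t‖ + ‖r t‖) / μ)) := by gcongr
        _ = ‖z‖ * t / μ * (‖p t‖ + ‖r t‖) ^ 2 := by ring
        _ ≤ ‖z‖ * t / μ * (2 * (‖p t‖ ^ 2 + ‖r t‖ ^ 2)) := by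
            gcongr; nlinarith [sq_nonneg (‖p t‖ - ‖r t‖)]
        _ = _ := by ring
    calc _ ≤ 2 * ((l + 1) / t * ‖p t‖ ^ 2 + ‖p t‖ * (‖z‖ * t * ‖g t‖)) +
          2 * ((l + 1) / t * ‖r t‖ ^ 2 + ‖r t‖ * (‖z‖ * t * ‖g t‖)) := by gcongr
      _ = 2 * ((l + 1) / t * (‖p t‖ ^ 2 + ‖r t‖ ^ 2)) +
          2 * ((‖p t‖ + ‖r t‖) * (‖z‖ * t * ‖g t‖)) := by ring
      _ ≤ 2 * ((l + 1) / t * (‖p t‖ ^ 2 + ‖r t‖ ^ 2)) +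
          2 * (2 * (‖z‖ * t / μ) * (‖p t‖ ^ 2 + ‖r t‖ ^ 2)) := by gcongr
      _ = _ := by ring

theorem norm_le_of_norm_deriv_le {f f' : ℝ → ℂ} {B B' : ℝ → ℝ} {a b : ℝ}
    (hf : ∀ t ∈ Icc a b, HasDerivAt f (f' t) t) (hB : ∀ t ∈ Icc a b, HasDerivAt B (B' t) t)
    (ha : ‖f a‖ ≤ B a) (h : ∀ t ∈ Icc a b, ‖f' t‖ ≤ B' t) : ∀ t ∈ Icc a b, ‖f t‖ ≤ B t :=
  fun _ ht => image_norm_le_of_norm_deriv_right_le_deriv_boundary'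
    (fun t ht => (hf t ht).continuousAt.continuousWithinAt)
    (fun t ht => (hf t (Ico_subset_Icc_self ht)).hasDerivWithinAt) ha
    (fun t ht => (hB t ht).continuousAt.continuousWithinAt)
    (fun t ht => (hB t (Ico_subset_Icc_self ht)).hasDerivWithinAt)
    (fun t ht => h t (Ico_subset_Icc_self ht)) ht

/-- The logarithmic case of `IsFreeSolution.bound_of_le_one`. -/
theorem IsFreeSolution.bound_of_le_one_log {z : ℂ} {g g' : ℝ → ℂ}
    (h : IsFreeSolution (-1 / 2) z g g') {x y : ℝ} (hx : 0 < x) (hxy : x ≤ y) (hy1 : y ≤ 1)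
    (hsy : Real.sqrt ‖z‖ * y ≤ 1) (h0 : g x = 0) (h1 : g' x = -1) :
    ‖g y‖ ≤ 3 * (Real.sqrt x * Real.sqrt y * (1 - Real.log x)) ∧
    y * ‖g' y‖ ≤ 3 * (Real.sqrt x * Real.sqrt y * (1 - Real.log x)) := by
  have hy : 0 < y := hx.trans_le hxy
  have hpos : ∀ t ∈ Icc x y, 0 < t := fun t ht => hx.trans_le ht.1
  -- The two exponents coincide at `1/2`. With `G = t^{-1/2} g` and `H = t G'` the equation becomes
  -- `H' = -z t G`, to be integrated twice against the maximum of `|G|`.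
  set G : ℝ → ℂ := fun t => ((t ^ (-1 / 2 : ℝ) : ℝ) : ℂ) * g t with hG
  set H : ℝ → ℂ := fun t => ((t ^ (-1 / 2 : ℝ) : ℝ) : ℂ) * (t * g' t - g t / 2) with hH
  have hdG : ∀ t ∈ Icc x y, HasDerivAt G (H t / t) t := fun t ht => by
    have ht0 := hpos t ht
    have ht' : (t : ℂ) ≠ 0 := by exact_mod_cast ht0.ne'
    refine ((hasDerivAt_ofReal_rpow ht0 (-1 / 2)).mul (h.hasDerivAt t ht0)).congr_deriv ?_
    simp only [hH]
    push_cast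
    field_simp
    ring
  have hdH : ∀ t ∈ Icc x y, HasDerivAt H (-(z * t * G t)) t := fun t ht => by
    have ht0 := hpos t ht
    have ht' : (t : ℂ) ≠ 0 := by exact_mod_cast ht0.ne'
    refine ((hasDerivAt_ofReal_rpow ht0 (-1 / 2)).mul (((hasDerivAt_id' t).ofReal_comp.mul
      (h.hasDerivAt_deriv t ht0)).sub ((h.hasDerivAt t ht0).div_const 2))).congr_deriv ?_
    simp only [hG, Pi.sub_apply, Pi.mul_apply]
    push_cast
    field_simp
    ring
  obtain ⟨t₀, ht₀, hmax⟩ := isCompact_Icc.exists_isMaxOn (nonempty_Icc.2 hxy)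
    (f := fun t => ‖G t‖) fun t ht => (hdG t ht).continuousAt.norm.continuousWithinAt
  set M := ‖G t₀‖ with hM
  have hM0 : 0 ≤ M := norm_nonneg _
  have hle : ∀ t ∈ Icc x y, ‖G t‖ ≤ M := fun t ht => hmax ht
  have hsx : x ^ (-1 / 2 : ℝ) * x = Real.sqrt x := by
    rw [← Real.rpow_add_one hx.ne', Real.sqrt_eq_rpow]; norm_num
  have hHx : ‖H x‖ = Real.sqrt x := by
    simp only [hH, h0, h1]
    rw [zero_div, sub_zero, mul_neg_one, mul_neg, norm_neg, ← Complex.ofReal_mul, hsx,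
      Complex.norm_real, Real.norm_of_nonneg (Real.sqrt_nonneg _)]
  have hzt : ∀ t ∈ Icc x y, ‖z‖ * t ^ 2 ≤ 1 := fun t ht => by
    rw [← Real.sq_sqrt (norm_nonneg z), ← mul_pow]
    have := hpos t ht
    exact pow_le_one₀ (by positivity) ((mul_le_mul_of_nonneg_left ht.2 (Real.sqrt_nonneg _)).trans hsy)
  have hHb : ∀ t ∈ Icc x y, ‖H t‖ ≤ Real.sqrt x + M * ‖z‖ / 2 * t ^ 2 := by
    refine norm_le_of_norm_deriv_le (B' := fun t => M * ‖z‖ * t) hdH (fun t ht => ?_) ?_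
      fun t ht => ?_
    · refine ((((hasDerivAt_id' t).pow 2).const_mul (M * ‖z‖ / 2)).const_add _).congr_deriv ?_
      push_cast; ring
    · rw [hHx]
      exact le_add_of_nonneg_right (by positivity)
    · have := hpos t ht
      rw [norm_neg, norm_mul, norm_mul, Complex.norm_real, Real.norm_of_nonneg this.le]
      calc _ ≤ ‖z‖ * t * M := by gcongr; exact hle t ht
        _ = _ := by ring
  have hGb : ∀ t ∈ Icc x y, ‖G t‖ ≤ Real.sqrt x * (Real.log t - Real.log x) +
      M * ‖z‖ / 4 * t ^ 2 := by
    refine norm_le_of_norm_deriv_le (B' := fun t => Real.sqrt x / t + M * ‖z‖ / 2 * t) hdG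
      (fun t ht => ?_) ?_ fun t ht => ?_
    · refine ((((Real.hasDerivAt_log (hpos t ht).ne').sub_const _).const_mul _).add
        (((hasDerivAt_id' t).pow 2).const_mul (M * ‖z‖ / 4))).congr_deriv ?_
      push_cast; ring
    · simp only [hG, h0, mul_zero, norm_zero, sub_self, zero_add]
      positivity
    · have ht0 := hpos t ht
      rw [norm_div, Complex.norm_real, Real.norm_of_nonneg ht0.le, div_le_iff₀ ht0]
      refine (hHb t ht).trans (le_of_eq ?_)
      field_simp
  have hlogle : ∀ t ∈ Icc x y, Real.log t ≤ 0 := fun t ht =>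
    Real.log_nonpos (hpos t ht).le (ht.2.trans hy1)
  set L := 1 - Real.log x with hL
  have hL1 : 1 ≤ L := by linarith [hlogle x (left_mem_Icc.2 hxy)]
  have hsx0 := Real.sqrt_nonneg x
  -- At the maximum point the bound reads `M ≤ √x L + M / 4`, and the last term is absorbed.
  have hMle : M ≤ 4 / 3 * (Real.sqrt x * L) := by
    have e1 := hGb t₀ ht₀
    have e2 : M * ‖z‖ / 4 * t₀ ^ 2 ≤ M / 4 := by nlinarith [hzt t₀ ht₀]
    have e3 : Real.sqrt x * (Real.log t₀ - Real.log x) ≤ Real.sqrt x * L := by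
      gcongr; linarith [hlogle t₀ ht₀]
    linarith
  have hym := right_mem_Icc.2 hxy
  have hHy : ‖H y‖ ≤ Real.sqrt x * L + M / 2 := by
    have e2 : M * ‖z‖ / 2 * y ^ 2 ≤ M / 2 := by nlinarith [hzt y hym]
    have := hHb y hym
    nlinarith
  have hGy := hle y hym
  have hyy : Real.sqrt y * y ^ (-1 / 2 : ℝ) = 1 := by
    rw [Real.sqrt_eq_rpow, ← Real.rpow_add hy]; norm_num
  have hyc : (Real.sqrt y : ℂ) * ((y ^ (-1 / 2 : ℝ) : ℝ) : ℂ) = 1 := by exact_mod_cast hyy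
  have eg : g y = (Real.sqrt y : ℂ) * G y := by
    simp only [hG]; linear_combination (-g y) * hyc
  have eg' : (y : ℂ) * g' y = (Real.sqrt y : ℂ) * (H y + G y / 2) := by
    simp only [hG, hH]; linear_combination (-(y * g' y)) * hyc
  have ns : ‖(Real.sqrt y : ℂ)‖ = Real.sqrt y := by
    rw [Complex.norm_real, Real.norm_of_nonneg (Real.sqrt_nonneg _)]
  have hP : 0 ≤ Real.sqrt x * L := mul_nonneg hsx0 (by linarith)
  constructor
  · rw [eg, norm_mul, ns]
    calc _ ≤ Real.sqrt y * (3 * (Real.sqrt x * L)) := by gcongr; linarith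
      _ = _ := by ring
  · have : y * ‖g' y‖ = ‖(y : ℂ) * g' y‖ := by
      rw [norm_mul, Complex.norm_real, Real.norm_of_nonneg hy.le]
    rw [this, eg', norm_mul, ns]
    have e : ‖H y + G y / 2‖ ≤ 3 * (Real.sqrt x * L) := by
      refine (norm_add_le _ _).trans ?_
      rw [norm_div, Complex.norm_two]
      linarith
    calc _ ≤ Real.sqrt y * (3 * (Real.sqrt x * L)) := by gcongr
      _ = _ := by ring

theorem one_le_logFactor {l x : ℝ} (hx : x ∈ Ioc (0 : ℝ) 1) : 1 ≤ logFactor l x := by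
  rw [logFactor]
  split_ifs
  · linarith [Real.log_nonpos hx.1.le hx.2]
  · exact le_rfl

theorem exists_bound_of_le_one {l : ℝ} (hl : -1 / 2 ≤ l) :
    ∃ C : ℝ, 0 ≤ C ∧ ∀ (z : ℂ) (g g' : ℝ → ℂ), IsFreeSolution l z g g' →
      ∀ x y : ℝ, 0 < x → x ≤ y → y ≤ 1 → Real.sqrt ‖z‖ * y ≤ 1 → g x = 0 → g' x = -1 →
      ‖g y‖ ≤ C * (x ^ (-l) * y ^ (l + 1) * logFactor l x) ∧
      y * ‖g' y‖ ≤ C * (x ^ (-l) * y ^ (l + 1) * logFactor l x) := by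
  rcases hl.eq_or_lt with rfl | hl
  · refine ⟨3, by norm_num, fun z g g' h x y hx hxy hy1 hsy h0 h1 => ?_⟩
    have := h.bound_of_le_one_log hx hxy hy1 hsy h0 h1
    rw [logFactor, if_pos rfl]
    rw [Real.sqrt_eq_rpow, Real.sqrt_eq_rpow] at this
    norm_num at this ⊢
    exact this
  · have hμ : 0 < 2 * l + 1 := by linarith
    refine ⟨2 * (|l| + |l + 1| + 1) / (2 * l + 1) * Real.exp (2 / (2 * l + 1)), by positivity,
      fun z g g' h x y hx hxy hy1 hsy h0 h1 => ?_⟩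
    rw [logFactor, if_neg hl.ne', mul_one]
    exact h.bound_of_le_one hl hx hxy hsy h0 h1

/-- The weight `x / (1 + |z|^{1/2} x)`. -/
noncomputable def weight (z : ℂ) (x : ℝ) : ℝ := x / (1 + Real.sqrt ‖z‖ * x)

theorem weight_pos (z : ℂ) {x : ℝ} (hx : 0 < x) : 0 < weight z x := by
  rw [weight]; positivity

theorem weight_le (z : ℂ) {x : ℝ} (hx : 0 < x) : weight z x ≤ x := by
  rw [weight]
  exact div_le_self hx.le (le_add_of_nonneg_right (by positivity))

/-- Together with `inv_le_two_mul_weight`, this says that the weight is within a factor `2` of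
`min(x, |z|^{-1/2})`, so one expression serves both regimes. -/
theorem le_two_mul_weight {z : ℂ} {x : ℝ} (hx : 0 < x) (h : Real.sqrt ‖z‖ * x ≤ 1) :
    x ≤ 2 * weight z x := by
  rw [weight, ← mul_div_assoc, le_div_iff₀ (by positivity)]
  nlinarith

theorem weight_le_inv {z : ℂ} (hz : z ≠ 0) {x : ℝ} (hx : 0 < x) :
    weight z x ≤ 1 / Real.sqrt ‖z‖ := by
  have hs0 : 0 < Real.sqrt ‖z‖ := Real.sqrt_pos.2 (norm_pos_iff.2 hz)
  rw [weight, div_le_div_iff₀ (by positivity) hs0]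
  linarith

theorem inv_le_two_mul_weight {z : ℂ} (hz : z ≠ 0) {x : ℝ} (hx : 0 < x)
    (h : 1 ≤ Real.sqrt ‖z‖ * x) : 1 / Real.sqrt ‖z‖ ≤ 2 * weight z x := by
  have hs0 : 0 < Real.sqrt ‖z‖ := Real.sqrt_pos.2 (norm_pos_iff.2 hz)
  rw [weight, ← mul_div_assoc, div_le_div_iff₀ hs0 (by positivity)]
  linarith

/-- The exponent `-l` may have either sign, hence the absolute value in the constant. -/
theorem rpow_le_two_rpow_mul {m x : ℝ} (p : ℝ) (hm : 0 < m) (hmx : m ≤ x) (hx : x ≤ 2 * m) :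
    x ^ p ≤ 2 ^ |p| * m ^ p := by
  rcases le_total 0 p with hp | hp
  · rw [abs_of_nonneg hp, ← Real.mul_rpow zero_le_two hm.le]
    exact Real.rpow_le_rpow (hm.le.trans hmx) hx hp
  · calc x ^ p ≤ m ^ p := Real.rpow_le_rpow_of_nonpos hm hmx hp
      _ ≤ 2 ^ |p| * m ^ p :=
        le_mul_of_one_le_left (by positivity) (Real.one_le_rpow one_le_two (abs_nonneg p))

/-- The bound for the fundamental solution of the free equation. -/
theorem exists_free_bound {l : ℝ} (hl : -1 / 2 ≤ l) :
    ∃ C : ℝ, 0 ≤ C ∧ ∀ (z : ℂ) (g g' : ℝ → ℂ), IsFreeSolution l z g g' →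
      ∀ x y : ℝ, 0 < x → x ≤ y → y ≤ 1 → g x = 0 → g' x = -1 →
      ‖g y‖ ≤ C * (weight z x ^ (-l) * weight z y ^ (l + 1) *
        Real.exp (|(csqrt z).im| * (y - x)) * logFactor l x) ∧
      ‖g' y‖ ≤ C * (weight z x ^ (-l) * weight z y ^ l *
        Real.exp (|(csqrt z).im| * (y - x)) * logFactor l x) := by
  obtain ⟨C₀, hC₀, hb⟩ := exists_bound_of_le_one hl
  set D : ℝ := 2 ^ |(-l)| * 2 ^ |l + 1| with hD
  have hD0 : 0 < D := by positivity
  set A := 2 * Real.exp |l * (l + 1)| with hA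
  have hA1 : 1 ≤ A := by
    have := Real.one_le_exp (abs_nonneg (l * (l + 1)))
    linarith
  refine ⟨A * (C₀ + 1) * D, by positivity, fun z g g' h x y hx hxy hy1 h0 h1 => ?_⟩
  have hy : 0 < y := hx.trans_le hxy
  set s := Real.sqrt ‖z‖ with hs
  set κ := |(csqrt z).im| with hκ
  set Λ := logFactor l x with hΛ
  have hΛ1 : 1 ≤ Λ := one_le_logFactor ⟨hx, hxy.trans hy1⟩
  have hmx := weight_pos z hx
  have hmy := weight_pos z hy
  set m := weight z x
  set n := weight z y
  set N := m ^ (-l) * n ^ (l + 1) * Real.exp (κ * (y - x)) * Λ with hN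
  have hN0 : 0 ≤ N := by positivity
  -- Multiplying the derivative by the weight at `y` gives both estimates the same right-hand side.
  suffices ‖g y‖ ≤ A * (C₀ + 1) * D * N ∧ n * ‖g' y‖ ≤ A * (C₀ + 1) * D * N by
    refine ⟨this.1, le_of_mul_le_mul_left (this.2.trans_eq ?_) hmy⟩
    rw [hN, Real.rpow_add_one hmy.ne']
    ring
  have hexp1 : 1 ≤ Real.exp (κ * (y - x)) :=
    Real.one_le_exp (mul_nonneg (abs_nonneg _) (sub_nonneg.2 hxy))
  have hAC : C₀ ≤ A * (C₀ + 1) := by nlinarith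
  have hAC1 : A ≤ A * (C₀ + 1) := by nlinarith
  -- Three cases according to the position of the threshold `1/s`: beyond `y`, between `x` and `y`,
  -- or before `x`. In the middle case the near-zero bound at `1/s` supplies the initial data of the
  -- energy estimate.
  rcases le_total (s * y) 1 with hsy | hsy
  · obtain ⟨b1, b2⟩ := hb z g g' h x y hx hxy hy1 hsy h0 h1
    have hsx : s * x ≤ 1 := (mul_le_mul_of_nonneg_left hxy (Real.sqrt_nonneg _)).trans hsy
    have hXY : C₀ * (x ^ (-l) * y ^ (l + 1) * Λ) ≤ A * (C₀ + 1) * D * N := by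
      calc _ ≤ C₀ * ((2 ^ |(-l)| * m ^ (-l)) * (2 ^ |l + 1| * n ^ (l + 1)) * Λ) := by
            gcongr
            · exact rpow_le_two_rpow_mul _ hmx (weight_le z hx) (le_two_mul_weight hx hsx)
            · exact rpow_le_two_rpow_mul _ hmy (weight_le z hy) (le_two_mul_weight hy hsy)
        _ = C₀ * D * (m ^ (-l) * n ^ (l + 1) * 1 * Λ) := by rw [hD]; ring
        _ ≤ A * (C₀ + 1) * D * N := by rw [hN]; gcongr
    refine ⟨b1.trans hXY, le_trans ?_ (b2.trans hXY)⟩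
    gcongr
    exact weight_le z hy
  · have hz : z ≠ 0 := by
      rintro rfl
      simp [hs] at hsy
      linarith
    have hs0 : 0 < s := Real.sqrt_pos.2 (norm_pos_iff.2 hz)
    have hni : n ≤ 1 / s := weight_le_inv hz hy
    have hyp : (1 / s) ^ (l + 1) ≤ 2 ^ |l + 1| * n ^ (l + 1) :=
      rpow_le_two_rpow_mul _ hmy hni (inv_le_two_mul_weight hz hy hsy)
    rcases le_total (s * x) 1 with hsx | hsx
    · have ha0 : 0 < 1 / s := by positivity
      have hxa : x ≤ 1 / s := by rw [le_div_iff₀ hs0, mul_comm]; exact hsx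
      have hay : 1 / s ≤ y := by rw [div_le_iff₀ hs0, mul_comm]; exact hsy
      have hsa : s * (1 / s) = 1 := by field_simp
      obtain ⟨b1, b2⟩ := hb z g g' h x (1 / s) hx hxa (hay.trans hy1) hsa.le h0 h1
      set B := C₀ * (x ^ (-l) * (1 / s) ^ (l + 1) * Λ) with hB
      have hB0 : 0 ≤ B := by positivity
      have b2' : ‖g' (1 / s)‖ ≤ s * B := by
        rw [one_div, inv_mul_le_iff₀ hs0] at b2
        rwa [← one_div] at b2
      obtain ⟨c1, c2⟩ := h.bound_of_one_le hz ha0 hsa.ge hay hB0 b1 b2'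
      have hXY : A * B * Real.exp (κ * (y - 1 / s)) ≤ A * (C₀ + 1) * D * N := by
        calc _ ≤ A * ((C₀ + 1) * ((2 ^ |(-l)| * m ^ (-l)) * (2 ^ |l + 1| * n ^ (l + 1)) * Λ)) *
              Real.exp (κ * (y - x)) := by
              rw [hB]
              gcongr
              · linarith
              · exact rpow_le_two_rpow_mul _ hmx (weight_le z hx) (le_two_mul_weight hx hsx)
          _ = _ := by rw [hD, hN]; ring
      refine ⟨c1.trans hXY, le_trans ?_ hXY⟩
      calc n * ‖g' y‖ ≤ 1 / s * (s * (A * B * Real.exp (κ * (y - 1 / s)))) := by gcongr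
        _ = _ := by field_simp
    · have hB0 : 0 ≤ 1 / s := by positivity
      obtain ⟨c1, c2⟩ := h.bound_of_one_le hz hx hsx hxy hB0 (by rw [h0, norm_zero]; exact hB0)
        (by rw [h1, norm_neg, norm_one, mul_one_div_cancel hs0.ne'])
      -- Both weights are comparable to `1/s` here, so the single factor `1/s` is split according to
      -- their exponents.
      have hone : 1 / s = (1 / s) ^ (-l) * (1 / s) ^ (l + 1) := by
        rw [← Real.rpow_add (by positivity)]; simp
      have hXY : A * (1 / s) * Real.exp (κ * (y - x)) ≤ A * (C₀ + 1) * D * N := by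
        calc _ ≤ A * (C₀ + 1) * ((2 ^ |(-l)| * m ^ (-l)) * (2 ^ |l + 1| * n ^ (l + 1)) * Λ) *
              Real.exp (κ * (y - x)) := by
              gcongr
              conv_lhs => rw [hone]
              refine le_trans (mul_le_mul ?_ hyp (by positivity) (by positivity))
                (le_mul_of_one_le_right (by positivity) hΛ1)
              exact rpow_le_two_rpow_mul _ hmx (weight_le_inv hz hx)
                (inv_le_two_mul_weight hz hx hsx)
          _ = _ := by rw [hD, hN]; ring
      refine ⟨c1.trans hXY, le_trans ?_ hXY⟩
      calc n * ‖g' y‖ ≤ 1 / s * (s * (A * (1 / s) * Real.exp (κ * (y - x)))) := by gcongr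
        _ = _ := by field_simp

/-! ### The perturbed equation -/

theorem Admissible.intervalIntegrable_mul_qTilde {l : ℝ} {q : ℝ → ℝ} (hq : Admissible l q)
    {a : ℝ} (ha : a ∈ Icc (0 : ℝ) 1) :
    IntervalIntegrable (fun x => x * qTilde l q x) volume a 1 := by
  rw [intervalIntegrable_iff_integrableOn_Ioo_of_le ha.2]
  exact hq.integrable.mono_set (Ioo_subset_Ioo_left ha.1)

theorem abs_le_qTilde {l : ℝ} {q : ℝ → ℝ} {x : ℝ} (hx : x ∈ Ioc (0 : ℝ) 1) :
    |q x| ≤ qTilde l q x :=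
  le_mul_of_one_le_left (abs_nonneg _) (one_le_logFactor hx)

theorem Admissible.intervalIntegrable {l : ℝ} {q : ℝ → ℝ} (hq : Admissible l q) {a : ℝ}
    (ha : a ∈ Ioc (0 : ℝ) 1) : IntervalIntegrable q volume a 1 := by
  rw [intervalIntegrable_iff_integrableOn_Ioo_of_le ha.2]
  have h := (hq.integrable.mono_set (Ioo_subset_Ioo_left ha.1.le)).const_mul (1 / a)
  refine h.mono' (hq.measurable.mono_measure (Measure.restrict_mono
    (Ioo_subset_Ioo_left ha.1.le) le_rfl)).aestronglyMeasurable ?_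
  refine (ae_restrict_iff' measurableSet_Ioo).2 (Eventually.of_forall fun x hx => ?_)
  have hx' : x ∈ Ioc (0 : ℝ) 1 := ⟨ha.1.trans hx.1, hx.2.le⟩
  have h1 := abs_le_qTilde (l := l) (q := q) hx'
  rw [Real.norm_eq_abs, ← mul_assoc]
  refine h1.trans (le_mul_of_one_le_left ((abs_nonneg _).trans h1) ?_)
  rw [div_mul_eq_mul_div, one_mul, one_le_div ha.1]
  exact hx.1.le

/-- The potential `l(l+1)/x² + q`. -/
noncomputable def potential (l : ℝ) (q : ℝ → ℝ) (x : ℝ) : ℝ := l * (l + 1) / x ^ 2 + q x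

theorem Admissible.intervalIntegrable_potential {l : ℝ} {q : ℝ → ℝ} (hq : Admissible l q) :
    ∀ a ∈ Ioc (0 : ℝ) 1, IntervalIntegrable (potential l q) volume a 1 := fun a ha =>
  (intervalIntegrable_of_continuousOn_Ioc (g := fun x : ℝ => l * (l + 1) / x ^ 2)
    (continuousOn_const.div (by fun_prop) fun x hx => pow_ne_zero 2 hx.1.ne') ha).add
    (hq.intervalIntegrable ha)

/-- `u`, with derivative `u'`, solves the initial value problem `u'' = (V - z) u`, `u(1) = α`,
`u'(1) = β` in integrated form. -/
structure IsIntegratedSolution (V : ℝ → ℝ) (z α β : ℂ) (u u' : ℝ → ℂ) : Prop where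
  continuousOn : ContinuousOn u (Ioc 0 1)
  continuousOn_deriv : ContinuousOn u' (Ioc 0 1)
  eq : ∀ x ∈ Ioc (0 : ℝ) 1, u x = α - ∫ t in x..1, u' t
  eq_deriv : ∀ x, u' x = β - ∫ t in x..1, ((V t : ℂ) - z) * u t

section

variable {V : ℝ → ℝ} {z α β : ℂ} {u u' : ℝ → ℂ}

theorem IsIntegratedSolution.hasDerivWithinAt (h : IsIntegratedSolution V z α β u u') {x : ℝ}
    (hx : x ∈ Ioc (0 : ℝ) 1) : HasDerivWithinAt u (u' x) (Ioc 0 1) x := by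
  have := (hasDerivWithinAt_integral_right h.continuousOn_deriv hx).const_sub α
  rw [neg_neg] at this
  exact this.congr h.eq (h.eq x hx)

theorem IsIntegratedSolution.ae_hasDerivAt_deriv
    (hV : ∀ a ∈ Ioc (0 : ℝ) 1, IntervalIntegrable V volume a 1)
    (h : IsIntegratedSolution V z α β u u') :
    ∀ᵐ x, x ∈ Ioc (0 : ℝ) 1 → HasDerivAt u' (((V x : ℂ) - z) * u x) x := by
  -- The exceptional null set depends on the left endpoint; countably many intervals `[1/(n+1), 1]`
  -- exhaust `(0, 1]`.
  have h1 : ∀ n : ℕ, (1 / ((n : ℝ) + 1)) ∈ Ioc (0 : ℝ) 1 := fun n =>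
    ⟨by positivity, by
      rw [div_le_one (by positivity)]
      exact le_add_of_nonneg_left (Nat.cast_nonneg n)⟩
  have h2 := fun n : ℕ => ae_hasDerivAt_integral_right
    (intervalIntegrable_potential_mul hV h.continuousOn z (h1 n))
  filter_upwards [ae_all_iff.2 h2] with x hx hx01
  obtain ⟨n, hn⟩ := exists_nat_one_div_lt hx01.1
  have h3 := (hx n (by rw [uIcc_of_le (h1 n).2]; exact ⟨hn.le, hx01.2⟩)).const_sub β
  rw [neg_neg] at h3
  exact h3.congr_of_eventuallyEq (Eventually.of_forall h.eq_deriv)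

theorem IsIntegratedSolution.absolutelyContinuous (h : IsIntegratedSolution V z α β u u')
    {a : ℝ} (ha : a ∈ Ioc (0 : ℝ) 1) : AbsolutelyContinuousOnInterval u a 1 := by
  refine absolutelyContinuousOnInterval_of_dist_le
    (absolutelyContinuousOnInterval_integral_right
      (intervalIntegrable_of_continuousOn_Ioc h.continuousOn_deriv ha)) fun x hx y hy => ?_
  rw [h.eq x (uIcc_subset_Ioc ha hx), h.eq y (uIcc_subset_Ioc ha hy), dist_sub_left]

theorem IsIntegratedSolution.absolutelyContinuous_deriv
    (hV : ∀ a ∈ Ioc (0 : ℝ) 1, IntervalIntegrable V volume a 1)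
    (h : IsIntegratedSolution V z α β u u') {a : ℝ} (ha : a ∈ Ioc (0 : ℝ) 1) :
    AbsolutelyContinuousOnInterval u' a 1 := by
  refine absolutelyContinuousOnInterval_of_dist_le
    (absolutelyContinuousOnInterval_integral_right
      (intervalIntegrable_potential_mul hV h.continuousOn z ha)) fun x _ y _ => ?_
  rw [h.eq_deriv x, h.eq_deriv y, dist_sub_left]

theorem IsIntegratedSolution.at_one (h : IsIntegratedSolution V z α β u u') :
    u 1 = α ∧ u' 1 = β := by
  constructor
  · simpa using h.eq 1 ⟨one_pos, le_rfl⟩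
  · simpa using h.eq_deriv 1

end

theorem IsIntegratedSolution.isSolution {l : ℝ} {q : ℝ → ℝ} (hq : Admissible l q) {z α β : ℂ}
    {u u' : ℝ → ℂ} (h : IsIntegratedSolution (potential l q) z α β u u') :
    IsSolution l q z u u' where
  hasDeriv _ hx := h.hasDerivWithinAt hx
  absCont _ ha := h.absolutelyContinuous_deriv hq.intervalIntegrable_potential ⟨ha.1, ha.2.le⟩
  equation := by
    rw [ae_restrict_iff' measurableSet_Ioo]
    filter_upwards [h.ae_hasDerivAt_deriv hq.intervalIntegrable_potential] with x hx hx01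
    refine ⟨_, hx ⟨hx01.1, hx01.2.le⟩, ?_⟩
    rw [potential]
    push_cast
    ring

theorem IsFreeSolution.continuousOn_deriv {l : ℝ} {z : ℂ} {g g' : ℝ → ℂ}
    (h : IsFreeSolution l z g g') : ContinuousOn g' (Ioc 0 1) := fun x hx =>
  (h.hasDerivAt_deriv x hx.1).continuousAt.continuousWithinAt

theorem IsFreeSolution.continuousOn {l : ℝ} {z : ℂ} {g g' : ℝ → ℂ}
    (h : IsFreeSolution l z g g') : ContinuousOn g (Ioc 0 1) := fun x hx =>
  (h.hasDerivAt x hx.1).continuousAt.continuousWithinAt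

theorem absolutelyContinuousOnInterval_of_hasDerivAt {f f' : ℝ → ℂ} {a b : ℝ}
    (h : ∀ x ∈ uIcc a b, HasDerivAt f (f' x) x) (hc : ContinuousOn f' (uIcc a b)) :
    AbsolutelyContinuousOnInterval f a b := by
  obtain ⟨C, hC⟩ := isCompact_uIcc.exists_bound_of_continuousOn hc
  have := (convex_uIcc a b).lipschitzOnWith_of_nnnorm_hasDerivWithin_le (C := C.toNNReal)
    (fun x hx => (h x hx).hasDerivWithinAt) fun x hx => by
      rw [← NNReal.coe_le_coe, coe_nnnorm, Real.coe_toNNReal']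
      exact (hC x hx).trans (le_max_left _ _)
  exact this.absolutelyContinuousOnInterval

/-- Variation of constants. -/
theorem IsIntegratedSolution.variation_of_constants {l : ℝ} {q : ℝ → ℝ} (hq : Admissible l q)
    {z α β : ℂ} {u u' : ℝ → ℂ} (h : IsIntegratedSolution (potential l q) z α β u u')
    {g g' : ℝ → ℂ} (hg : IsFreeSolution l z g g') {x : ℝ} (hx : x ∈ Ioc (0 : ℝ) 1)
    (h0 : g x = 0) (h1 : g' x = -1) :
    IntervalIntegrable (fun y => g y * (q y : ℂ) * u y) volume x 1 ∧
    u x = g 1 * β - g' 1 * α - ∫ y in x..1, g y * (q y : ℂ) * u y := by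
  have hV := hq.intervalIntegrable_potential
  have hsub := uIcc_subset_Ioc hx
  have hqi : IntervalIntegrable (fun y => (q y : ℂ)) volume x 1 :=
    ⟨(hq.intervalIntegrable hx).1.ofReal, (hq.intervalIntegrable hx).2.ofReal⟩
  have hint : IntervalIntegrable (fun y => g y * (q y : ℂ) * u y) volume x 1 :=
    (hqi.continuousOn_mul (hg.continuousOn.mono hsub)).mul_continuousOn (h.continuousOn.mono hsub)
  refine ⟨hint, ?_⟩
  have hg1 : AbsolutelyContinuousOnInterval g x 1 :=
    absolutelyContinuousOnInterval_of_hasDerivAt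
      (fun y hy => hg.hasDerivAt y (hsub hy).1) (hg.continuousOn_deriv.mono hsub)
  have hg2 : AbsolutelyContinuousOnInterval g' x 1 := by
    refine absolutelyContinuousOnInterval_of_hasDerivAt
      (fun y hy => hg.hasDerivAt_deriv y (hsub hy).1) (ContinuousOn.mul ?_
        (hg.continuousOn.mono hsub))
    refine ContinuousOn.sub (Complex.continuous_ofReal.comp_continuousOn ?_) continuousOn_const
    exact continuousOn_const.div (by fun_prop) fun y hy => pow_ne_zero 2 (hsub hy).1.ne'
  have hW := (hg1.fun_smul (h.absolutelyContinuous_deriv hV hx)).fun_sub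
    (hg2.fun_smul (h.absolutelyContinuous hx))
  -- In `(g u' - g' u)'` the terms `l(l+1)/x² - z` cancel and `g q u` remains. The point `1` is
  -- discarded because `u` is only differentiated from the left there.
  have key := integral_eq_sub_of_ae_hasDerivAt hW hint (by
    have hne : ∀ᵐ y : ℝ, y ≠ 1 := compl_mem_ae_iff.2 (measure_singleton (1 : ℝ))
    filter_upwards [h.ae_hasDerivAt_deriv hV, hne] with y hy hy1 hyx
    have hy01 := hsub hyx
    have hu : HasDerivAt u (u' y) y := (h.hasDerivWithinAt hy01).hasDerivAt
      (Ioc_mem_nhds hy01.1 (lt_of_le_of_ne hy01.2 hy1))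
    simp only [smul_eq_mul]
    refine (((hg.hasDerivAt y hy01.1).mul (hy hy01)).sub
      ((hg.hasDerivAt_deriv y hy01.1).mul hu)).congr_deriv ?_
    rw [potential]
    push_cast
    ring)
  simp only [smul_eq_mul, h0, h1, h.at_one] at key
  rw [key]
  ring

theorem weight_mul_logFactor_mul {l : ℝ} {q : ℝ → ℝ} (z : ℂ) (y : ℝ) :
    weight z y * logFactor l y * |q y| = y * qTilde l q y / (1 + Real.sqrt ‖z‖ * y) := by
  rw [weight, qTilde]; ring

theorem continuousOn_logFactor (l : ℝ) : ContinuousOn (logFactor l) (Ioc 0 1) := by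
  unfold logFactor
  split_ifs
  · exact continuousOn_const.sub (Real.continuousOn_log.mono fun x hx => hx.1.ne')
  · exact continuousOn_const

theorem continuousOn_weight (z : ℂ) : ContinuousOn (weight z) (Ioc 0 1) := by
  unfold weight
  exact continuousOn_id.div (by fun_prop) fun x hx => by have := hx.1; positivity

/-- The Grönwall estimate for a solution of the integral equation. -/
theorem norm_sub_free_le {l : ℝ} {q : ℝ → ℝ} (hq : Admissible l q) {z : ℂ} {u f : ℝ → ℂ}
    {G : ℝ → ℝ → ℂ} {C F : ℝ} (hC : 0 ≤ C) (hF : 0 ≤ F) (hu : ContinuousOn u (Ioc 0 1))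
    (hG : ∀ x y : ℝ, 0 < x → x ≤ y → y ≤ 1 → ‖G x y‖ ≤ C * (weight z x ^ (-l) *
      weight z y ^ (l + 1) * Real.exp (|(csqrt z).im| * (y - x)) * logFactor l x))
    (hf : ∀ x ∈ Ioc (0 : ℝ) 1, ‖f x‖ ≤ F * (weight z x ^ (-l) *
      Real.exp (|(csqrt z).im| * (1 - x)) * logFactor l x))
    (h : ∀ x ∈ Ioc (0 : ℝ) 1, u x = f x - ∫ y in x..1, G x y * (q y : ℂ) * u y)
    {x : ℝ} (hx : x ∈ Ioc (0 : ℝ) 1) :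
    ‖u x - f x‖ ≤ C * F * Real.exp (C * ∫ y in (0 : ℝ)..1, y * qTilde l q y) *
      (weight z x ^ (-l) * Real.exp (|(csqrt z).im| * (1 - x)) * logFactor l x *
        ∫ y in x..1, y * qTilde l q y / (1 + Real.sqrt ‖z‖ * y)) := by
  set κ := |(csqrt z).im| with hκ
  set s := Real.sqrt ‖z‖ with hs
  -- Chosen so that `|G(x,y)| |q(y)| M(y) ≤ C M(x) w(y)`: the exponentials telescope, the powers at
  -- `y` combine to the weight itself, and `Λ(y)` turns `|q|` into `q̃`.
  set M : ℝ → ℝ := fun x => weight z x ^ (-l) * Real.exp (κ * (1 - x)) * logFactor l x with hM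
  set w : ℝ → ℝ := fun y => y * qTilde l q y / (1 + s * y) with hw
  have hΛ0 : ∀ y ∈ Ioc (0 : ℝ) 1, 0 < logFactor l y := fun y hy =>
    one_pos.trans_le (one_le_logFactor hy)
  have hMpos : ∀ y ∈ Ioc (0 : ℝ) 1, 0 < M y := fun y hy =>
    mul_pos (mul_pos (Real.rpow_pos_of_pos (weight_pos z hy.1) _) (Real.exp_pos _)) (hΛ0 y hy)
  have hMc : ContinuousOn M (Ioc 0 1) :=
    (((continuousOn_weight z).rpow_const fun y hy => Or.inl (weight_pos z hy.1).ne').mul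
      (by fun_prop)).mul (continuousOn_logFactor l)
  have hqt0 : ∀ y ∈ Ioc (0 : ℝ) 1, 0 ≤ y * qTilde l q y := fun y hy =>
    mul_nonneg hy.1.le ((abs_nonneg _).trans (abs_le_qTilde hy))
  have hw0 : ∀ y ∈ Ioc (0 : ℝ) 1, 0 ≤ w y := fun y hy =>
    div_nonneg (hqt0 y hy) (by have := hy.1; positivity)
  have hwle : ∀ y ∈ Ioc (0 : ℝ) 1, w y ≤ y * qTilde l q y := fun y hy =>
    div_le_self (hqt0 y hy) (le_add_of_nonneg_right (by have := hy.1; positivity))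
  have hwi : ∀ a ∈ Ioc (0 : ℝ) 1, IntervalIntegrable w volume a 1 := fun a ha => by
    simp only [hw, div_eq_mul_inv]
    refine (hq.intervalIntegrable_mul_qTilde ⟨ha.1.le, ha.2⟩).mul_continuousOn
      (ContinuousOn.inv₀ (by fun_prop) fun y hy => ?_)
    have := (uIcc_subset_Ioc ha hy).1
    positivity
  -- This bound is free of `z` and `a`, which makes the Grönwall constant uniform.
  have hwQ : ∀ a ∈ Ioc (0 : ℝ) 1, ∫ y in a..1, w y ≤ ∫ y in (0 : ℝ)..1, y * qTilde l q y := by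
    intro a ha
    calc _ ≤ ∫ y in a..1, y * qTilde l q y :=
          intervalIntegral.integral_mono_on ha.2 (hwi a ha)
            (hq.intervalIntegrable_mul_qTilde ⟨ha.1.le, ha.2⟩) fun y hy =>
              hwle y (mem_Ioc_of_mem_Icc ha hy)
      _ ≤ _ := intervalIntegral.integral_mono_interval ha.1.le ha.2 le_rfl
          ((ae_restrict_iff' measurableSet_Ioc).2 (Eventually.of_forall hqt0))
          (hq.intervalIntegrable_mul_qTilde ⟨le_rfl, zero_le_one⟩)
  set ρ : ℝ → ℝ := fun y => ‖u y‖ / M y with hρ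
  have hρc : ContinuousOn ρ (Ioc 0 1) := hu.norm.div hMc fun y hy => (hMpos y hy).ne'
  have hwρ : ∀ a ∈ Ioc (0 : ℝ) 1, IntervalIntegrable (fun y => C * w y * ρ y) volume a 1 :=
    fun a ha => ((hwi a ha).const_mul C).mul_continuousOn (hρc.mono (uIcc_subset_Ioc ha))
  have hdiff : ∀ a ∈ Ioc (0 : ℝ) 1, ‖u a - f a‖ ≤ M a * ∫ y in a..1, C * w y * ρ y := by
    intro a ha
    rw [h a ha, sub_sub_cancel_left, norm_neg, ← intervalIntegral.integral_const_mul]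
    refine intervalIntegral.norm_integral_le_of_norm_le ha.2
      (Eventually.of_forall fun y hy => ?_) ((hwρ a ha).const_mul _)
    have hy01 : y ∈ Ioc (0 : ℝ) 1 := ⟨ha.1.trans hy.1, hy.2⟩
    have hm := weight_pos z hy01.1
    have hu' : ‖u y‖ = ρ y * M y := by
      simp only [hρ]; rw [div_mul_cancel₀ _ (hMpos y hy01).ne']
    have hρ0 : 0 ≤ ρ y := div_nonneg (norm_nonneg _) (hMpos y hy01).le
    rw [norm_mul, norm_mul, Complex.norm_real, Real.norm_eq_abs, hu']
    calc _ ≤ C * (weight z a ^ (-l) * weight z y ^ (l + 1) * Real.exp (κ * (y - a)) *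
          logFactor l a) * |q y| * (ρ y * M y) := by
          have := (hMpos y hy01).le
          gcongr
          exact hG a y ha.1 hy.1.le hy.2
      _ = C * weight z a ^ (-l) * logFactor l a *
          (Real.exp (κ * (y - a)) * Real.exp (κ * (1 - y))) *
          (weight z y ^ (l + 1) * weight z y ^ (-l)) * logFactor l y * |q y| * ρ y := by
          simp only [hM]; ring
      _ = C * weight z a ^ (-l) * logFactor l a * Real.exp (κ * (1 - a)) *
          (weight z y * logFactor l y * |q y|) * ρ y := by
          rw [← Real.exp_add, ← Real.rpow_add hm, show l + 1 + -l = 1 by ring, Real.rpow_one]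
          ring_nf
      _ = _ := by rw [weight_mul_logFactor_mul]; simp only [hM, hw]; ring
  have hρle : ∀ a ∈ Ioc (0 : ℝ) 1,
      ρ a ≤ F * Real.exp (C * ∫ y in (0 : ℝ)..1, y * qTilde l q y) := by
    intro a ha
    refine (le_mul_exp_of_le_add_integral (A := F) ha.2 (hρc.mono fun y hy => mem_Ioc_of_mem_Icc ha hy)
      ((hwi a ha).const_mul C) (fun y hy => mul_nonneg hC (hw0 y (mem_Ioc_of_mem_Icc ha hy)))
      fun y hy => ?_).trans ?_
    · have hy01 := mem_Ioc_of_mem_Icc ha hy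
      simp only [hρ]
      rw [div_le_iff₀ (hMpos y hy01)]
      have h1 := hdiff y hy01
      have h2 := hf y hy01
      have h3 := norm_add_le (f y) (u y - f y)
      rw [add_sub_cancel] at h3
      simp only [hρ] at h1
      calc ‖u y‖ ≤ F * M y + M y * ∫ t in y..1, C * w t * (‖u t‖ / M t) := by linarith
        _ = _ := by ring
    · rw [intervalIntegral.integral_const_mul]
      gcongr
      exact hwQ a ha
  -- The a priori bound on `ρ` is fed back into the integral inequality, so the tail integral of `w`
  -- survives as a factor.
  refine (hdiff x hx).trans ?_
  have : ∫ y in x..1, C * w y * ρ y ≤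
      ∫ y in x..1, C * F * Real.exp (C * ∫ y in (0 : ℝ)..1, y * qTilde l q y) * w y := by
    refine intervalIntegral.integral_mono_on hx.2 (hwρ x hx) ((hwi x hx).const_mul _)
      fun y hy => ?_
    have hy01 := mem_Ioc_of_mem_Icc hx hy
    have h1 := mul_le_mul_of_nonneg_left (hρle y hy01) (mul_nonneg hC (hw0 y hy01))
    refine h1.trans_eq ?_
    ring
  rw [intervalIntegral.integral_const_mul] at this
  refine (mul_le_mul_of_nonneg_left this (hMpos x hx).le).trans_eq ?_
  simp only [hM]
  ring

/-- Existence and estimates for the solution with data `u(1) = α`, `u'(1) = β`. -/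
theorem exists_solution {l : ℝ} {q : ℝ → ℝ} (hq : Admissible l q) (α β : ℂ) :
    ∃ ψ ψ' : ℂ → ℝ → ℂ,
      (∀ z, IsSolution l q z (ψ z) (ψ' z) ∧ ψ z 1 = α ∧ ψ' z 1 = β) ∧
      (∀ x ∈ Ioc (0 : ℝ) 1, Differentiable ℂ fun z => ψ z x) ∧
      ∃ f : ℂ → ℝ → ℂ, (∀ z x, f z x = green l z x 1 * β -
          (phiFree l z x * deriv (thetaFree l z) 1 - deriv (phiFree l z) 1 * thetaFree l z x) * α) ∧
        (∀ z, ∀ x ∈ Ioc (0 : ℝ) 1,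
          IntervalIntegrable (fun y => green l z x y * (q y : ℂ) * ψ z y) volume x 1 ∧
          ψ z x = f z x - ∫ y in x..1, green l z x y * (q y : ℂ) * ψ z y) ∧
        ∃ C : ℝ, 0 ≤ C ∧ ∀ z, ∀ x ∈ Ioc (0 : ℝ) 1, ‖ψ z x - f z x‖ ≤
          C * logFactor l x * (‖β‖ * (1 / (1 + Real.sqrt ‖z‖)) + ‖α‖) * errorBound l q z x := by
  obtain ⟨ψ, ψ', hc, hc', he, he', hd⟩ :=
    exists_entire_solution hq.intervalIntegrable_potential α β
  have hψ : ∀ z, IsIntegratedSolution (potential l q) z α β (ψ z) (ψ' z) :=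
    fun z => ⟨hc z, hc' z, he z, he' z⟩
  obtain ⟨C, hC, hb⟩ := exists_free_bound hq.le_l
  choose p r hp hr hW using exists_free_solutions hq.le_l
  -- The kernel is a linear combination of `φ_l` and `θ_l` in `y`; `hg0` and `hg1` give its data `0`
  -- and `-1` at `y = x`, the latter from the Wronskian.
  have hg : ∀ z x, IsFreeSolution l z (fun y => green l z x y)
      (fun y => phiFree l z x * r z y - p z y * thetaFree l z x) := fun z x =>
    ⟨fun y hy => (((hr z).hasDerivAt y hy).const_mul _).sub (((hp z).hasDerivAt y hy).mul_const _),
      fun y hy => ((((hr z).hasDerivAt_deriv y hy).const_mul _).sub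
        (((hp z).hasDerivAt_deriv y hy).mul_const _)).congr_deriv (by simp only [green]; ring)⟩
  have hg0 : ∀ z x, green l z x x = 0 := fun z x => by simp only [green]; ring
  have hg1 : ∀ z x, 0 < x → phiFree l z x * r z x - p z x * thetaFree l z x = -1 :=
    fun z x hx => by linear_combination -hW z x hx
  have hG : ∀ (z : ℂ) (x y : ℝ), 0 < x → x ≤ y → y ≤ 1 → _ := fun z x y hx hxy hy =>
    hb z _ _ (hg z x) x y hx hxy hy (hg0 z x) (hg1 z x hx)
  have hr1 : ∀ z, deriv (thetaFree l z) 1 = r z 1 := fun z => ((hr z).hasDerivAt 1 one_pos).deriv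
  have hp1 : ∀ z, deriv (phiFree l z) 1 = p z 1 := fun z => ((hp z).hasDerivAt 1 one_pos).deriv
  refine ⟨ψ, ψ', fun z => ⟨(hψ z).isSolution hq, (hψ z).at_one⟩, hd, _, fun z x => rfl,
    fun z x hx => ?_, C * C * Real.exp (C * ∫ y in (0 : ℝ)..1, y * qTilde l q y), by positivity,
    fun z x hx => ?_⟩
  · rw [hr1, hp1]
    exact (hψ z).variation_of_constants hq (hg z x) hx (hg0 z x) (hg1 z x hx.1)
  · set n := weight z 1 with hn
    have hn1 : n = 1 / (1 + Real.sqrt ‖z‖) := by rw [hn, weight, mul_one]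
    have hn0 : 0 < n := weight_pos z one_pos
    -- In `F`, the kernel at `y = 1` contributes `n^{l+1}` to the coefficient of `β`, and its
    -- `y`-derivative contributes `n^l` to that of `α`.
    have key := norm_sub_free_le hq (z := z) (u := ψ z) (G := green l z)
      (f := fun x => green l z x 1 * β - (phiFree l z x * deriv (thetaFree l z) 1 -
        deriv (phiFree l z) 1 * thetaFree l z x) * α)
      (F := C * (n ^ l * (‖β‖ * n + ‖α‖))) hC (by positivity) (hc z)
      (fun x y hx hxy hy => (hG z x y hx hxy hy).1) (fun x hx => ?_) (fun x hx => ?_) hx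
    · refine key.trans_eq ?_
      -- The quotient in `errorBound` is the ratio of the weights at `1` and at `x`.
      have hE : errorBound l q z x = weight z x ^ (-l) * n ^ l *
          Real.exp (|(csqrt z).im| * (1 - x)) *
          ∫ y in x..1, y * qTilde l q y / (1 + Real.sqrt ‖z‖ * y) := by
        rw [errorBound]
        congr 2
        have hx0 := hx.1
        rw [Real.rpow_neg (weight_pos z hx0).le, ← Real.inv_rpow (weight_pos z hx0).le,
          ← Real.mul_rpow (inv_nonneg.2 (weight_pos z hx0).le) hn0.le]
        congr 1
        rw [hn1, weight]
        field_simp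
      rw [hE, ← hn1]
      ring
    · rw [hr1, hp1]
      obtain ⟨b1, b2⟩ := hG z x 1 hx.1 hx.2 le_rfl
      rw [← hn, Real.rpow_add_one hn0.ne'] at b1
      rw [← hn] at b2
      calc _ ≤ ‖green l z x 1‖ * ‖β‖ +
            ‖phiFree l z x * r z 1 - p z 1 * thetaFree l z x‖ * ‖α‖ := by
            rw [← norm_mul, ← norm_mul]; exact norm_sub_le _ _
        _ ≤ _ := add_le_add (mul_le_mul_of_nonneg_right b1 (norm_nonneg _))
            (mul_le_mul_of_nonneg_right b2 (norm_nonneg _))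
        _ = _ := by ring
    · rw [hr1, hp1]
      exact ((hψ z).variation_of_constants hq (hg z x) hx (hg0 z x) (hg1 z x hx.1)).2

theorem errorBound_nonneg (l : ℝ) (q : ℝ → ℝ) (z : ℂ) {x : ℝ} (hx : x ∈ Ioc (0 : ℝ) 1) :
    0 ≤ errorBound l q z x := by
  have hx0 := hx.1
  refine mul_nonneg (by positivity) (intervalIntegral.integral_nonneg hx.2 fun y hy => ?_)
  have hy := mem_Ioc_of_mem_Icc hx hy
  have hy0 := hy.1
  have := (abs_nonneg _).trans (abs_le_qTilde (l := l) (q := q) hy)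
  positivity

end SphericalSchrodinger

/-! ### Specialization to the two kinds of boundary condition -/

theorem mainTheorem5 (l : ℝ) (q : ℝ → ℝ) (hq : Admissible l q) :
    (∀ β : ℝ, ∃ ψ ψ' : ℂ → ℝ → ℂ,
      (∀ z : ℂ, IsSolution l q z (ψ z) (ψ' z) ∧ ψ z 1 = 1 ∧ ψ' z 1 = -(β : ℂ)) ∧
      (∀ x ∈ Ioc (0 : ℝ) 1, Differentiable ℂ (fun z => ψ z x)) ∧
      (∀ z : ℂ, ∀ x ∈ Ioc (0 : ℝ) 1,
        IntervalIntegrable (fun y => green l z x y * (q y : ℂ) * ψ z y) volume x 1 ∧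
        ψ z x = psiFree l β z x - ∫ y in x..1, green l z x y * (q y : ℂ) * ψ z y) ∧
      ∃ C : ℝ, ∀ z : ℂ, ∀ x ∈ Ioc (0 : ℝ) 1,
        ‖ψ z x - psiFree l β z x‖ ≤ C * logFactor l x * errorBound l q z x) ∧
    (∃ ψ ψ' : ℂ → ℝ → ℂ,
      (∀ z : ℂ, IsSolution l q z (ψ z) (ψ' z) ∧ ψ z 1 = 0 ∧ ψ' z 1 = 1) ∧
      (∀ x ∈ Ioc (0 : ℝ) 1, Differentiable ℂ (fun z => ψ z x)) ∧
      (∀ z : ℂ, ∀ x ∈ Ioc (0 : ℝ) 1,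
        IntervalIntegrable (fun y => green l z x y * (q y : ℂ) * ψ z y) volume x 1 ∧
        ψ z x = psiFreeInf l z x - ∫ y in x..1, green l z x y * (q y : ℂ) * ψ z y) ∧
      ∃ C : ℝ, ∀ z : ℂ, ∀ x ∈ Ioc (0 : ℝ) 1,
        ‖ψ z x - psiFreeInf l z x‖ ≤
          C * logFactor l x * (1 / (1 + Real.sqrt ‖z‖)) * errorBound l q z x) := by
  constructor
  · intro β
    obtain ⟨ψ, ψ', h1, h2, f, hf, h3, C, hC, h4⟩ := exists_solution hq 1 (-(β : ℂ))
    have hfree : ∀ z x, f z x = psiFree l β z x := fun z x => by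
      rw [hf, psiFree, green]; ring
    simp only [hfree] at h3 h4
    -- The datum `u(1) = 1` enters without decay in `z`, so the factor `1 / (1 + |z|^{1/2})` on
    -- `|β|` is simply bounded by `1`.
    refine ⟨ψ, ψ', h1, h2, h3, C * (|β| + 1), fun z x hx => (h4 z x hx).trans ?_⟩
    have hΛ := zero_le_one.trans (one_le_logFactor (l := l) hx)
    have hs : 1 / (1 + Real.sqrt ‖z‖) ≤ 1 :=
      (div_le_one (by positivity)).2 (le_add_of_nonneg_right (Real.sqrt_nonneg _))
    rw [norm_neg, Complex.norm_real, Real.norm_eq_abs, norm_one]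
    refine mul_le_mul_of_nonneg_right ?_ (errorBound_nonneg l q z hx)
    calc _ ≤ C * logFactor l x * (|β| * 1 + 1) := by gcongr
      _ = _ := by ring
  -- With `u(1) = 0` only the derivative datum remains, and the gain in `z` is kept.
  · obtain ⟨ψ, ψ', h1, h2, f, hf, h3, C, -, h4⟩ := exists_solution hq 0 1
    have hfree : ∀ z x, f z x = psiFreeInf l z x := fun z x => by
      rw [hf, psiFreeInf, green]; ring
    simp only [hfree, norm_one, norm_zero, one_mul, add_zero] at h3 h4
    exact ⟨ψ, ψ', h1, h2, h3, C, h4⟩
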